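/- Let $(R,\mathfrak m,k)$ be a Gorenstein local ring, i.e. a Noetherian local ring of finite injective dimension as a module over itself. For an $R$-module $M$ write $\beta_i^R(M)=\dim_k \operatorname{Tor}_i^R(k,M)$ for its $i$-th Betti number. Let $I$ be an ideal of $R$ with $$\beta_1^R(I)-\beta_0^R(I)=-1\quad\text{and}\quad \beta_1^R(I)\neq 0.$$ Then $\operatorname{pd}_R(I)=1$. Moreover, one of the following holds: 1. $I$ is a perfect ideal of grade $2$, that is, $R/I$ is a Cohen–Macaulay $R$-module of finite projective dimension and $\operatorname{grade}(I)=2$; 2. $\operatorname{grade}(I)=1$, the ideal $I$ is not unmixed (that is, the associated primes of $R/I$ do not all have the same height), and the unmixed part $I^{\mathrm{unm}}$ is a principal ideal. Here $\operatorname{grade}(I)$ is the maximal length of an $R$-regular sequence in $I$, and $I^{\mathrm{unm}}$ is the intersection of those primary components of $I$ whose height equals $\operatorname{ht}(I)$. -/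

import Mathlib

open CategoryTheory

universe u

/-- Base change of modules along a ring homomorphism is an additive functor. -/
instance extendScalars_additive {R S : Type u} [CommRing R] [CommRing S] (f : R →+* S) :
    (ModuleCat.extendScalars.{u, u, u} f).Additive :=
  (ModuleCat.extendRestrictScalarsAdj.{u, u, u} f).left_adjoint_additive

/-- A Gorenstein local ring: a Noetherian local ring which has finite injective dimension as a
module over itself. -/
class IsGorensteinLocalRing (R : Type u) [CommRing R] : Prop
    extends IsLocalRing R, IsNoetherianRing R where
  injectiveDimension_ne_top : injectiveDimension (ModuleCat.of R R) ≠ ⊤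

/-- The `i`-th Betti number `dim_k Tor_i^R(k, M)` of a module `M` over a local ring `R` with residue
field `k`. Here `Tor_i^R(k, -)` is the `i`-th left derived functor of `k ⊗_R -`, regarded as a
functor from `R`-modules to `k`-vector spaces. -/
noncomputable def bettiNumber (R : Type u) [CommRing R] [IsLocalRing R]
    (M : Type u) [AddCommGroup M] [Module R M] (i : ℕ) : ℕ :=
  Module.finrank (IsLocalRing.ResidueField R)
    (((ModuleCat.extendScalars.{u, u, u} (IsLocalRing.residue R)).leftDerived i).obj
      (ModuleCat.of R M))

/-- The projective dimension of an `R`-module (equal to `⊥` exactly for the zero module). -/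
noncomputable def projDim (R : Type u) [CommRing R]
    (M : Type u) [AddCommGroup M] [Module R M] : WithBot ℕ∞ :=
  projectiveDimension (ModuleCat.of R M)

/-- The grade of the ideal `I` on the module `M`: the supremum of the lengths of the `M`-regular
sequences with all terms in `I`. -/
noncomputable def gradeOn {R : Type u} [CommRing R] (I : Ideal R)
    (M : Type u) [AddCommGroup M] [Module R M] : ℕ∞ :=
  ⨆ (rs : List R) (_ : RingTheory.Sequence.IsRegular M rs) (_ : ∀ r ∈ rs, r ∈ I), (rs.length : ℕ∞)

/-- The grade of a (proper) ideal `I` of `R`: the supremum of the lengths of the `R`-regular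
sequences in `I`. -/
noncomputable def idealGrade {R : Type u} [CommRing R] (I : Ideal R) : ℕ∞ :=
  gradeOn I R

/-- A Cohen-Macaulay module over a (Noetherian) local ring: a finitely generated module which is
zero or whose depth equals its Krull dimension. -/
structure IsCohenMacaulayModule (R : Type u) [CommRing R] [IsLocalRing R]
    (M : Type u) [AddCommGroup M] [Module R M] : Prop where
  finite : Module.Finite R M
  depth_eq_dim : Subsingleton M ∨
    ((gradeOn (IsLocalRing.maximalIdeal R) M : ℕ∞) : WithBot ℕ∞) = Module.supportDim R M

/-- A perfect module: a Cohen-Macaulay module of finite projective dimension. -/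
structure IsPerfectModule (R : Type u) [CommRing R] [IsLocalRing R]
    (M : Type u) [AddCommGroup M] [Module R M] : Prop where
  cohenMacaulay : IsCohenMacaulayModule R M
  projDim_ne_top : projDim R M ≠ ⊤

/-- An ideal `I` is perfect if `R ⧸ I` is a perfect module. -/
def IsPerfectIdeal {R : Type u} [CommRing R] [IsLocalRing R] (I : Ideal R) : Prop :=
  IsPerfectModule R (R ⧸ I)

/-- A module is unmixed if all its associated primes have the same height. -/
def IsUnmixedModule (R : Type u) [CommRing R]
    (M : Type u) [AddCommGroup M] [Module R M] : Prop :=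
  ∀ p ∈ associatedPrimes R M, ∀ q ∈ associatedPrimes R M, p.height = q.height

/-- An ideal `I` is unmixed if `R ⧸ I` is an unmixed module. -/
def IsUnmixedIdeal {R : Type u} [CommRing R] (I : Ideal R) : Prop :=
  IsUnmixedModule R (R ⧸ I)

/-- The unmixed part of an ideal `I`: the intersection of all primary components of `I` (members of
some minimal primary decomposition of `I`) whose height is the height of `I`. (For `I` a proper
ideal of a Noetherian ring these components belong to minimal primes of `I`, hence do not depend on
the decomposition.) -/
noncomputable def unmixedPart {R : Type u} [CommRing R] (I : Ideal R) : Ideal R :=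
  sInf {q : Ideal R | q.height = I.height ∧
    ∃ t : Finset (Ideal R), Submodule.IsMinimalPrimaryDecomposition I t ∧ q ∈ t}

/-! Let `m` be the first Betti number, so that `I` has `m + 1` minimal generators `g` and `m`
minimal relations `c`. At a minimal prime the local ring is Artinian, and counting lengths
(`exact_of_isArtinianRing`) shows that there the relations are independent and `g` generates the
unit ideal. A Gorenstein ring has no embedded primes, so both facts globalize: `c` is independent
and `I` contains a nonzerodivisor. Hence 0 → R^m → R^(m+1) → I → 0 is exact; since the first Betti
number is nonzero, `I` is not projective, and its projective dimension is 1.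

By Hilbert-Burch (`hilbertBurch`), `I = aJ` with `a` a nonzerodivisor and `J` the ideal of maximal
minors of `c`. `J` lies in no associated prime of `R ⧸ (b)` for any nonzerodivisor `b`, and it is
proper because `I` is not principal; so it contains a regular sequence of length two. If `a` is a
unit, then `I = J`, and the resolution makes the depth of `R ⧸ I` at least dim R - 2, which is also
an upper bound for its dimension. If `a` is not a unit, then `I ⊆ (a)` has grade 1, `R ⧸ J` embeds
in `R ⧸ I` and contributes associated primes of height at least 2, and the unmixed part is `(a)`.

The Gorenstein hypothesis enters through `height_le_length_of_mem_associatedPrimes`, which follows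
from Cohen-Macaulayness; the latter is deduced from finite injective dimension by vanishing of Ext.
-/

/-! ### Vanishing of Ext and the dimension of Gorenstein local rings -/

open Abelian RingTheory.Sequence IsLocalRing Pointwise in
/-- If `rs` is an `M`-regular sequence annihilating `N` and `Hom(N, M/rs M) ≠ 0`, then
`Ext(N, M)` does not vanish in degree the length of `rs`. -/
theorem not_subsingleton_ext_length {R : Type u} [CommRing R] [IsNoetherianRing R]
    (N : ModuleCat.{u} R) [Module.Finite R N] (rs : List R)
    (hN : ∀ r ∈ rs, r ∈ Module.annihilator R N)
    (M : ModuleCat.{u} R) [Module.Finite R M] (reg : IsRegular M rs)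
    (hom : ¬ Subsingleton (N →ₗ[R] (M ⧸ Ideal.ofList rs • (⊤ : Submodule R M)))) :
    ¬ Subsingleton (Ext N M rs.length) := by
  induction rs generalizing M with
  | nil =>
    intro h
    apply hom
    have : Subsingleton (N →ₗ[R] M) :=
      (Ext.addEquiv₀.trans ModuleCat.homAddEquiv).symm.subsingleton
    have e : (M ⧸ Ideal.ofList ([] : List R) • (⊤ : Submodule R M)) ≃ₗ[R] M :=
      Submodule.quotEquivOfEqBot _ (by simp)
    exact (LinearEquiv.congrRight (M := N) e).subsingleton
  | cons r rs ih =>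
    intro h
    -- Ext(N, M/rM) in degree `rs.length` sits between Ext(N, M) in degrees `rs.length` and
    -- `rs.length + 1`. The first vanishes because `N` is killed by a longer `M`-regular sequence,
    -- the second by the assumption to be refuted.
    have hlen : Subsingleton (Ext N M rs.length) := by
      refine ModuleCat.subsingleton_ext_of_exists_isRegular (Ideal.ofList (r :: rs)) N ?_ M
        (lt_top_iff_ne_top.mpr reg.top_ne_smul.symm) (r :: rs)
        (fun x hx => Ideal.subset_span hx) reg _ (by simp)
      rw [Module.support_eq_zeroLocus]
      refine PrimeSpectrum.zeroLocus_anti_mono ?_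
      exact Ideal.span_le.mpr hN
    simp only [isRegular_cons_iff] at reg
    refine ih (fun r hr => hN r (List.mem_cons_of_mem _ hr)) (ModuleCat.of R (QuotSMulTop r M))
      reg.2 ?_ ?_
    · intro h'
      apply hom
      exact (LinearEquiv.congrRight (M := N)
        (Submodule.quotOfListConsSMulTopEquivQuotSMulTopInner M r rs)).subsingleton
    · have zero1 := AddCommGrpCat.isZero_of_iff_subsingleton.mpr hlen
      have zero2 := AddCommGrpCat.isZero_of_iff_subsingleton.mpr h
      exact AddCommGrpCat.subsingleton_of_isZero <| ShortComplex.Exact.isZero_of_both_zeros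
        ((Ext.covariant_sequence_exact₃' N reg.1.smulShortComplex_shortExact) rs.length
          (rs.length + 1) rfl)
        (zero1.eq_zero_of_src _) (zero2.eq_zero_of_tgt _)

open Abelian IsLocalRing Pointwise in
/-- If `Ext` into `M` vanishes in degree `i + 1` on finite modules, then it vanishes in degree `i`
on `R ⧸ p` for every nonmaximal prime `p`. -/
theorem subsingleton_ext_quotient_of_ne_maximalIdeal {R : Type u} [CommRing R] [IsLocalRing R]
    [IsNoetherianRing R] (M : ModuleCat.{u} R) [Module.Finite R M] (i : ℕ)
    (h : ∀ N : ModuleCat.{u} R, Module.Finite R N → Subsingleton (Ext N M (i + 1)))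
    (p : Ideal R) [p.IsPrime] (hp : p ≠ maximalIdeal R) :
    Subsingleton (Ext (ModuleCat.of R (R ⧸ p)) M i) := by
  -- For `x` in the maximal ideal but not in `p`, the vanishing one degree higher on `R ⧸ (p, x)`
  -- makes multiplication by `x` surjective on Ext(R/p, M) in degree `i`; Nakayama's lemma
  -- concludes.
  obtain ⟨x, hxm, hxp⟩ := SetLike.exists_of_lt
    (lt_of_le_of_ne (le_maximalIdeal (Ideal.IsPrime.ne_top ‹_›)) hp)
  have reg : IsSMulRegular (R ⧸ p) x := by
    intro a b hab
    have hx : Ideal.Quotient.mk p x ≠ 0 := by rwa [Ne, Ideal.Quotient.eq_zero_iff_mem]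
    simp only [Algebra.smul_def, Ideal.Quotient.algebraMap_eq] at hab
    exact mul_left_cancel₀ hx hab
  let S := (ModuleCat.of R (R ⧸ p)).smulShortComplex x
  have hS : S.ShortExact := reg.smulShortComplex_shortExact
  have zero := h (ModuleCat.of R (QuotSMulTop x (R ⧸ p))) inferInstance
  have exac := Ext.contravariant_sequence_exact₁' hS M i (i + 1) (add_comm 1 i)
  have epi := exac.epi_f ((@AddCommGrpCat.isZero_of_subsingleton _ zero).eq_zero_of_tgt _)
  have hf : S.f = x • 𝟙 (ModuleCat.of R (R ⧸ p)) := rfl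
  simp only [AddCommGrpCat.epi_iff_surjective, AddCommGrpCat.hom_ofHom] at epi
  by_contra! ntr
  have : x ∈ (Module.annihilator R (Ext (ModuleCat.of R (R ⧸ p)) M i)).jacobson :=
    (IsLocalRing.maximalIdeal_le_jacobson _) hxm
  absurd Submodule.top_ne_pointwise_smul_of_mem_jacobson_annihilator this
  rw [eq_comm, eq_top_iff]
  intro y hy
  rcases epi y with ⟨z, hz⟩
  have hxz (z : Ext (ModuleCat.of R (R ⧸ p)) M i) :
      (Ext.mk₀ (x • 𝟙 (ModuleCat.of R (R ⧸ p)))).comp z (zero_add i) ∈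
        x • (⊤ : Submodule R (Ext (ModuleCat.of R (R ⧸ p)) M i)) := by
    rw [Ext.mk₀_smul, Ext.smul_comp, Ext.mk₀_id_comp]
    exact Submodule.smul_mem_pointwise_smul z x ⊤ trivial
  rw [hf] at hz
  rw [← hz]
  exact hxz z

open Abelian IsLocalRing in
/-- If `Ext` into `M` vanishes in degree `i + 1` on finite modules and in degree `i` on the residue
field, then it vanishes in degree `i` on finite modules. -/
theorem subsingleton_ext_of_residueField {R : Type u} [CommRing R] [IsLocalRing R]
    [IsNoetherianRing R] (M : ModuleCat.{u} R) [Module.Finite R M] (i : ℕ)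
    (h : ∀ N : ModuleCat.{u} R, Module.Finite R N → Subsingleton (Ext N M (i + 1)))
    (hk : Subsingleton (Ext (ModuleCat.of R (R ⧸ maximalIdeal R)) M i))
    (N : ModuleCat.{u} R) [hN : Module.Finite R N] : Subsingleton (Ext N M i) := by
  have key : ∀ (N : Type u) [AddCommGroup N] [Module R N] [Module.Finite R N],
      Subsingleton (Ext (ModuleCat.of R N) M i) := by
    intro N _ _ hN
    induction hN using IsNoetherianRing.induction_on_isQuotientEquivQuotientPrime R with
    | subsingleton N =>
      have : Limits.IsZero (ModuleCat.of R N) := ModuleCat.isZero_of_subsingleton _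
      have := this.hasProjectiveDimensionLT_zero
      exact HasProjectiveDimensionLT.subsingleton _ 0 i (Nat.zero_le _) M
    | quotient N p e =>
      have hp : Subsingleton (Ext (ModuleCat.of R (R ⧸ p.1)) M i) := by
        by_cases hpm : p.1 = maximalIdeal R
        · rw [hpm]; exact hk
        · have := p.2
          exact subsingleton_ext_quotient_of_ne_maximalIdeal M i h p.1 hpm
      have e' : ModuleCat.of R N ≅ ModuleCat.of R (R ⧸ p.1) := e.toModuleIso
      refine ⟨fun a b => ?_⟩
      have inj : Function.Injective
          (fun a : Ext (ModuleCat.of R N) M i => (Ext.mk₀ e'.inv).comp a (zero_add i)) := by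
        intro a b hab
        have := congrArg (fun c => (Ext.mk₀ e'.hom).comp c (zero_add i)) hab
        simpa using this
      exact inj (Subsingleton.elim _ _)
    | exact N₁ N₂ N₃ f g hf hg hfg h₁ h₃ =>
      let S : ShortComplex (ModuleCat.{u} R) :=
        ModuleCat.shortComplexOfCompEqZero f g hfg.linearMap_comp_eq_zero
      have hS : S.ShortExact := ModuleCat.shortComplex_shortExact S hfg hf hg
      exact AddCommGrpCat.subsingleton_of_isZero <| ShortComplex.Exact.isZero_of_both_zeros
        (Ext.contravariant_sequence_exact₂' hS M i)
        ((AddCommGrpCat.isZero_of_iff_subsingleton.mpr h₃).eq_zero_of_src _)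
        ((AddCommGrpCat.isZero_of_iff_subsingleton.mpr h₁).eq_zero_of_tgt _)
  exact key N

open Pointwise in
/-- A prime associated to a module with a regular sequence of length `n` has height at most
`dim R - n`. -/
theorem height_add_length_le_ringKrullDim {R : Type u} [CommRing R] [IsLocalRing R]
    [IsNoetherianRing R] (rs : List R) (M : Type u) [AddCommGroup M] [Module R M]
    [Module.Finite R M] (reg : RingTheory.Sequence.IsRegular M rs) (p : Ideal R)
    (hp : p ∈ associatedPrimes R M) :
    ((p.height + rs.length : ℕ∞) : WithBot ℕ∞) ≤ ringKrullDim R := by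
  induction rs generalizing M p with
  | nil =>
    have := hp.isPrime
    simpa using Ideal.height_le_ringKrullDim_of_isPrime
  | cons x rs ih =>
    have hpp := hp.isPrime
    have hxm : x ∈ IsLocalRing.maximalIdeal R := by
      simpa using fun isu ↦ reg.2 (by simp [Ideal.span_singleton_eq_top.mpr isu])
    rw [RingTheory.Sequence.isRegular_cons_iff] at reg
    have hxp : x ∉ p := by
      intro hx
      have : x ∈ ⋃ q ∈ associatedPrimes R M, (q : Set R) := Set.mem_biUnion hp hx
      rw [biUnion_associatedPrimes_eq_compl_regular] at this
      exact this reg.1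
    -- `N` is nonzero because `p` is associated. If it lay in `xM`, regularity of `x` would give `N
    -- ⊆ xN`, contradicting Nakayama. So some element killed by `p` survives in `M/xM`, and an
    -- associated prime containing its annihilator contains `p` and `x`.
    let N : Submodule R M := Submodule.torsionBySet R M p
    have hN0 : N ≠ ⊥ := by
      obtain ⟨-, y, hy⟩ := isAssociatedPrime_iff.mp hp
      intro h0
      have hyN : y ∈ N := by
        rw [Submodule.mem_torsionBySet_iff]
        rintro ⟨a, ha⟩
        rw [SetLike.mem_coe, hy] at ha
        simpa [Submodule.mem_colon_singleton] using ha
      rw [h0, Submodule.mem_bot] at hyN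
      apply hpp.ne_top
      rw [hy, hyN]
      ext; simp [Submodule.mem_colon_singleton]
    have hNx : ¬ N ≤ x • (⊤ : Submodule R M) := by
      intro hle
      apply hN0
      refine Submodule.eq_bot_of_le_smul_of_le_jacobson_bot (Ideal.span {x}) N
        (IsNoetherian.noetherian N) ?_ ?_
      · intro n hn
        obtain ⟨m, -, rfl⟩ := (Submodule.mem_smul_pointwise_iff_exists _ _ _).mp (hle hn)
        refine Submodule.smul_mem_smul (Ideal.mem_span_singleton_self x) ?_
        rw [Submodule.mem_torsionBySet_iff] at hn ⊢
        intro a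
        apply reg.1
        have := hn a
        simp only [smul_zero]
        rw [smul_comm] at this
        exact this
      · rw [Ideal.span_le, Set.singleton_subset_iff, SetLike.mem_coe,
          IsLocalRing.jacobson_eq_maximalIdeal _ bot_ne_top]
        exact hxm
    obtain ⟨n, hn, hnx⟩ := SetLike.not_le_iff_exists.mp hNx
    obtain ⟨q, hq, hqn⟩ := exists_le_isAssociatedPrime_of_isNoetherianRing R
      (Submodule.Quotient.mk n : QuotSMulTop x M)
      (by rwa [Ne, Submodule.Quotient.mk_eq_zero])
    have hqp := hq.isPrime
    have hpq : p < q := by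
      refine lt_of_le_of_ne (fun a ha => hqn ?_) ?_
      · rw [Submodule.mem_colon_singleton, ← Submodule.Quotient.mk_smul,
          (Submodule.mem_torsionBySet_iff _ _).mp hn ⟨a, ha⟩]
        simp
      · rintro rfl
        apply hxp
        apply hqn
        rw [Submodule.mem_colon_singleton, ← Submodule.Quotient.mk_smul, Submodule.mem_bot,
          Submodule.Quotient.mk_eq_zero]
        exact Submodule.smul_mem_pointwise_smul n x ⊤ trivial
    refine le_trans ?_ (ih (QuotSMulTop x M) reg.2 q hq)
    have := Ideal.height_add_one_le_of_lt_of_isPrime hpq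
    norm_cast
    push_cast [List.length_cons]
    calc p.height + (rs.length + 1) = (p.height + 1) + rs.length := by ring
      _ ≤ _ := by gcongr

open Abelian RingTheory.Sequence IsLocalRing in
/-- Over a Gorenstein local ring, if `R ⧸ rs` has depth zero then `Ext(-, R)` vanishes on finite
modules in degrees greater than the length of the regular sequence `rs`. -/
theorem subsingleton_ext_self_of_length_lt {R : Type u} [CommRing R] [IsGorensteinLocalRing R]
    (rs : List R) (reg : IsRegular R rs)
    (hm : maximalIdeal R ∈ associatedPrimes R (R ⧸ Ideal.ofList rs))
    (i : ℕ) (hi : rs.length < i) (N : ModuleCat.{u} R) [Module.Finite R N] :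
    Subsingleton (Ext N (ModuleCat.of R R) i) := by
  obtain ⟨n, hn⟩ := (injectiveDimension_ne_top_iff _).mp
    (IsGorensteinLocalRing.injectiveDimension_ne_top (R := R))
  have : Module.Finite R (ModuleCat.of R R) := inferInstanceAs (Module.Finite R R)
  have pd : HasProjectiveDimensionLT (ModuleCat.of R (R ⧸ Ideal.ofList rs)) (rs.length + 1) := by
    have := ModuleCat.projectiveDimension_quotient_eq_length.{u} rs reg
    rw [projectiveDimension_eq_of_iso (Shrink.linearEquiv R (R ⧸ Ideal.ofList rs)).toModuleIso]
      at this
    exact (projectiveDimension_le_iff _ _).mp this.le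
  -- Descending induction on the degree `i`, starting from `n + 1`, beyond the injective dimension;
  -- `j` bounds the distance still to go.
  have key : ∀ j i : ℕ, rs.length < i → n + 1 ≤ i + j → ∀ N : ModuleCat.{u} R,
      Module.Finite R N → Subsingleton (Ext N (ModuleCat.of R R) i) := by
    intro j
    induction j with
    | zero =>
      intro i _ hij N _
      exact HasInjectiveDimensionLT.subsingleton (ModuleCat.of R R) (n + 1) i hij N
    | succ j ih =>
      intro i hi hij N hN
      have h := ih (i + 1) (by omega) (by omega)
      refine subsingleton_ext_of_residueField (ModuleCat.of R R) i h ?_ N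
      -- The residue field embeds in `R ⧸ rs`. Its Ext in degree `i` lies between that of `R ⧸ rs`,
      -- zero by projective dimension, and that of the cokernel in degree `i + 1`, zero by
      -- induction.
      obtain ⟨-, f, hf⟩ := (isAssociatedPrime_iff_exists_injective_linearMap _ _).mp hm
      let S : ShortComplex (ModuleCat.{u} R) :=
        ModuleCat.shortComplexOfCompEqZero f (LinearMap.range f).mkQ
          (LinearMap.exact_map_mkQ_range f).linearMap_comp_eq_zero
      have hS : S.ShortExact := ModuleCat.shortComplex_shortExact S
        (LinearMap.exact_map_mkQ_range f) hf (Submodule.mkQ_surjective _)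
      have h₂ : Subsingleton (Ext S.X₂ (ModuleCat.of R R) i) :=
        HasProjectiveDimensionLT.subsingleton (ModuleCat.of R (R ⧸ Ideal.ofList rs))
          (rs.length + 1) i hi _
      have h₃ : Subsingleton (Ext S.X₃ (ModuleCat.of R R) (i + 1)) :=
        h (ModuleCat.of R ((R ⧸ Ideal.ofList rs) ⧸ LinearMap.range f)) inferInstance
      exact AddCommGrpCat.subsingleton_of_isZero <| ShortComplex.Exact.isZero_of_both_zeros
        (Ext.contravariant_sequence_exact₁' hS (ModuleCat.of R R) i (i + 1) (add_comm 1 i))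
        ((AddCommGrpCat.isZero_of_iff_subsingleton.mpr h₂).eq_zero_of_src _)
        ((AddCommGrpCat.isZero_of_iff_subsingleton.mpr h₃).eq_zero_of_tgt _)
  exact key (n + 1) i hi (by omega) N inferInstance

open Abelian RingTheory.Sequence IsLocalRing in
/-- Over a Gorenstein local ring, if `R ⧸ rs` has depth zero for a regular sequence `rs`, then the
length of `rs` is the dimension of `R`. -/
theorem ringKrullDim_eq_length {R : Type u} [CommRing R] [IsGorensteinLocalRing R]
    (rs : List R) (reg : IsRegular R rs)
    (hm : maximalIdeal R ∈ associatedPrimes R (R ⧸ Ideal.ofList rs)) :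
    ringKrullDim R = rs.length := by
  have : Module.Finite R (ModuleCat.of R R) := inferInstanceAs (Module.Finite R R)
  -- For another associated prime `p`, Ext(R/p, R) would vanish in degree `rs.length`, although the
  -- embedding of `R ⧸ p` in `R ⧸ rs` forces it to be nonzero.
  have hass : ∀ p ∈ associatedPrimes R (R ⧸ Ideal.ofList rs), p = maximalIdeal R := by
    intro p hp
    by_contra hne
    have := hp.isPrime
    have h1 := subsingleton_ext_quotient_of_ne_maximalIdeal (ModuleCat.of R R) rs.length
      (fun N hN => subsingleton_ext_self_of_length_lt rs reg hm _ (Nat.lt_succ_self _) N) p hne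
    refine not_subsingleton_ext_length (ModuleCat.of R (R ⧸ p)) rs ?_ (ModuleCat.of R R) reg ?_ h1
    · intro r hr
      change r ∈ Module.annihilator R (R ⧸ p)
      rw [Ideal.annihilator_quotient]
      refine hp.annihilator_le ?_
      rw [Submodule.annihilator_top, Ideal.annihilator_quotient]
      exact Ideal.subset_span hr
    · obtain ⟨-, f, hf⟩ := (isAssociatedPrime_iff_exists_injective_linearMap _ _).mp hp
      intro hsub
      have e : (R ⧸ Ideal.ofList rs) ≃ₗ[R] (R ⧸ Ideal.ofList rs • (⊤ : Submodule R R)) :=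
        Submodule.quotEquivOfEq _ _ (by simp)
      have h0 : (e.toLinearMap ∘ₗ f : (R ⧸ p) →ₗ[R] _) = 0 := @Subsingleton.elim _ hsub _ _
      have : Function.Injective (0 : (R ⧸ p) →ₗ[R] (R ⧸ Ideal.ofList rs • (⊤ : Submodule R R))) := by
        rw [← h0]; exact e.injective.comp hf
      have := Ideal.Quotient.nontrivial_iff.mpr (Ideal.IsPrime.ne_top ‹p.IsPrime›)
      exact zero_ne_one (α := R ⧸ p) (‹Function.Injective _› rfl)
  have hdim : Ring.KrullDimLE 0 (R ⧸ Ideal.ofList rs) := by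
    rw [Ideal.krullDimLE_zero_quotient_iff_forall_minimalPrimes_isMaximal]
    intro p hp
    rw [hass p (Module.associatedPrimes.minimalPrimes_annihilator_subset_associatedPrimes
      R _ (by rwa [Ideal.annihilator_quotient]))]
    infer_instance
  have hnt : Nontrivial (R ⧸ Ideal.ofList rs) := by
    refine Ideal.Quotient.nontrivial_iff.mpr ?_
    simpa using reg.top_ne_smul.symm
  have := ringKrullDim_add_length_eq_ringKrullDim_of_isRegular rs reg
  rw [← this, ringKrullDimZero_iff_ringKrullDim_eq_zero.mp hdim, zero_add]

/-! ### Cohen-Macaulayness, unmixedness and heights -/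

open RingTheory.Sequence IsLocalRing in
theorem RingTheory.Sequence.IsRegular.mem_maximalIdeal {R : Type u} [CommRing R] [IsLocalRing R]
    {M : Type u} [AddCommGroup M] [Module R M] {rs : List R} (reg : IsRegular M rs)
    {r : R} (hr : r ∈ rs) : r ∈ maximalIdeal R := by
  by_contra h
  have hu : IsUnit r := by simpa using h
  apply reg.top_ne_smul
  rw [(Ideal.ofList rs).eq_top_of_isUnit_mem (Ideal.subset_span hr) hu, Submodule.top_smul]

theorem exists_natCast_eq_ringKrullDim (R : Type u) [CommRing R] [IsLocalRing R]
    [IsNoetherianRing R] : ∃ d : ℕ, ringKrullDim R = d := by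
  have h0 := ringKrullDim_nonneg_of_nontrivial (R := R)
  have h1 := ringKrullDim_lt_top (R := R)
  generalize ringKrullDim R = e at h0 h1
  induction e with
  | bot => simp at h0
  | coe e =>
    induction e with
    | top => simp at h1
    | coe n => exact ⟨n, rfl⟩

open RingTheory.Sequence IsLocalRing in
/-- Over a Gorenstein local ring every regular sequence extends to one of length `dim R`; in other
words, Gorenstein local rings are Cohen-Macaulay. -/
theorem exists_isRegular_append {R : Type u} [CommRing R] [IsGorensteinLocalRing R]
    (rs : List R) (reg : IsRegular R rs) :
    ∃ rs', IsRegular R (rs ++ rs') ∧ ringKrullDim R = (rs ++ rs').length := by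
  obtain ⟨d, hd⟩ := exists_natCast_eq_ringKrullDim R
  -- `k` counts the extensions still possible: a regular sequence has length at most `d`, so `k = 0`
  -- is absurd.
  have key : ∀ (k : ℕ) (rs : List R), IsRegular R rs → d < rs.length + k →
      ∃ rs', IsRegular R (rs ++ rs') ∧ ringKrullDim R = (rs ++ rs').length := by
    intro k
    induction k with
    | zero =>
      intro rs reg hk
      exfalso
      have hnt : Nontrivial (R ⧸ Ideal.ofList rs) :=
        Ideal.Quotient.nontrivial_iff.mpr (by simpa using reg.top_ne_smul.symm)
      have h0 := ringKrullDim_nonneg_of_nontrivial (R := R ⧸ Ideal.ofList rs)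
      have h1 := ringKrullDim_add_length_eq_ringKrullDim_of_isRegular rs reg
      rw [hd] at h1
      have h2 : ((rs.length : ℕ) : WithBot ℕ∞) ≤ (d : ℕ) := by
        rw [← h1]; exact le_add_of_nonneg_left h0
      have h3 : rs.length ≤ d := by exact_mod_cast h2
      omega
    | succ k ih =>
      intro rs reg hk
      by_cases hm : maximalIdeal R ∈ associatedPrimes R (R ⧸ Ideal.ofList rs)
      · exact ⟨[], by simpa using reg, by simpa using ringKrullDim_eq_length rs reg hm⟩
      · obtain ⟨x, hxm, hx⟩ : ∃ x ∈ maximalIdeal R, IsSMulRegular (R ⧸ Ideal.ofList rs) x := by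
          by_contra! hcon
          obtain ⟨p, hp, hle⟩ :=
            ((maximalIdeal R).subset_union_prime_finite (associatedPrimes.finite R
              (R ⧸ Ideal.ofList rs)) (f := id) ⊥ ⊥ (fun _ h _ _ => h.isPrime)).1 <| by
                simp_rw [id, biUnion_associatedPrimes_eq_compl_regular]
                exact fun x hx h => hcon x hx h
          exact hm ((maximalIdeal.isMaximal R).eq_of_le hp.isPrime.ne_top hle ▸ hp)
        have reg' : IsRegular R (rs ++ [x]) := by
          refine IsRegular.of_isWeaklyRegular_of_mem_maximalIdeal R ?_ ?_
          · intro r hr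
            rcases List.mem_append.mp hr with hr | hr
            · exact reg.mem_maximalIdeal hr
            · rwa [List.mem_singleton.mp hr]
          · rw [isWeaklyRegular_append_iff, isWeaklyRegular_singleton_iff]
            refine ⟨reg.toIsWeaklyRegular, ?_⟩
            have e : (R ⧸ Ideal.ofList rs) ≃ₗ[R] (R ⧸ Ideal.ofList rs • (⊤ : Submodule R R)) :=
              Submodule.quotEquivOfEq _ _ (by simp)
            exact (e.isSMulRegular_congr x).mp hx
        obtain ⟨rs', h1, h2⟩ := ih (rs ++ [x]) reg' (by simp; omega)
        exact ⟨x :: rs', by simpa using h1, by simpa using h2⟩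
  exact key (d + 1) rs reg (by omega)

open RingTheory.Sequence IsLocalRing in
/-- Unmixedness: over a Gorenstein local ring the associated primes of `R ⧸ rs`, for a regular
sequence `rs`, have height at most the length of `rs`. -/
theorem height_le_length_of_mem_associatedPrimes {R : Type u} [CommRing R]
    [IsGorensteinLocalRing R] (rs : List R) (reg : IsRegular R rs) (p : Ideal R)
    (hp : p ∈ associatedPrimes R (R ⧸ Ideal.ofList rs)) : p.height ≤ rs.length := by
  -- The complementary sequence `rs'` is regular on `R ⧸ rs`, so the height of `p` plus its length
  -- is at most dim R, the sum of the two lengths.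
  obtain ⟨rs', h1, h2⟩ := exists_isRegular_append rs reg
  have e : (R ⧸ Ideal.ofList rs) ≃ₗ[R] (R ⧸ Ideal.ofList rs • (⊤ : Submodule R R)) :=
    Submodule.quotEquivOfEq _ _ (by simp)
  have hw := ((isWeaklyRegular_append_iff _ _ _).mp h1.toIsWeaklyRegular).2
  have hnt : Nontrivial (R ⧸ Ideal.ofList rs • (⊤ : Submodule R R)) :=
    IsRegular.quot_ofList_smul_nontrivial reg ⊤
  have hreg : IsRegular (R ⧸ Ideal.ofList rs • (⊤ : Submodule R R)) rs' :=
    IsRegular.of_isWeaklyRegular_of_mem_maximalIdeal _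
      (fun r hr => h1.mem_maximalIdeal (List.mem_append_right _ hr)) hw
  have := height_add_length_le_ringKrullDim rs' _ hreg p
    (by rwa [← LinearEquiv.AssociatedPrimes.eq e])
  rw [h2] at this
  have h3 : p.height + (rs'.length : ℕ∞) ≤ rs.length + rs'.length := by
    rw [List.length_append] at this
    exact_mod_cast this
  exact (ENat.add_le_add_iff_right (ENat.natCast_ne_top _)).mp h3

/-- Gorenstein local rings have no embedded primes. -/
theorem height_eq_zero_of_mem_associatedPrimes {R : Type u} [CommRing R]
    [IsGorensteinLocalRing R] (p : Ideal R) (hp : p ∈ associatedPrimes R R) : p.height = 0 := by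
  have e : (R ⧸ Ideal.ofList ([] : List R)) ≃ₗ[R] R := Submodule.quotEquivOfEqBot _ (by simp)
  simpa using height_le_length_of_mem_associatedPrimes [] (.nil R R) p
    (by rwa [LinearEquiv.AssociatedPrimes.eq e])

open nonZeroDivisors in
/-- Principal ideals generated by nonzerodivisors of a Gorenstein local ring are unmixed. -/
theorem height_le_one_of_mem_associatedPrimes {R : Type u} [CommRing R]
    [IsGorensteinLocalRing R] {b : R} (hb : b ∈ R⁰) (p : Ideal R)
    (hp : p ∈ associatedPrimes R (R ⧸ Ideal.span {b})) : p.height ≤ 1 := by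
  have e : (R ⧸ Ideal.ofList [b]) ≃ₗ[R] R ⧸ Ideal.span {b} :=
    Submodule.quotEquivOfEq _ _ (by simp)
  have hbp : b ∈ p := by
    refine hp.annihilator_le ?_
    rw [Submodule.annihilator_top, Ideal.annihilator_quotient]
    exact Ideal.mem_span_singleton_self b
  have reg : RingTheory.Sequence.IsRegular R [b] := by
    refine RingTheory.Sequence.IsRegular.of_isWeaklyRegular_of_mem_maximalIdeal R ?_ ?_
    · intro r hr
      rw [List.mem_singleton.mp hr]
      exact IsLocalRing.le_maximalIdeal hp.isPrime.ne_top hbp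
    · rw [RingTheory.Sequence.isWeaklyRegular_singleton_iff]
      exact Module.Flat.isSMulRegular_of_nonZeroDivisors hb
  simpa using height_le_length_of_mem_associatedPrimes [b] reg p
    (by rwa [LinearEquiv.AssociatedPrimes.eq e])

open nonZeroDivisors in
theorem one_le_height_of_mem_nonZeroDivisors {R : Type u} [CommRing R] {b : R} (hb : b ∈ R⁰)
    (p : Ideal R) [p.IsPrime] (hbp : b ∈ p) : 1 ≤ p.height := by
  exact (Ideal.one_le_height_span_singleton_of_mem_nonZeroDivisors hb).trans
    (Ideal.height_mono (by simpa using hbp))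

-- A minimal prime of `I` strictly below `p` would contain `b`, so have height at least 1, and `p`
-- would have height at least 2.
open nonZeroDivisors in
theorem mem_minimalPrimes_of_height_le_one {R : Type u} [CommRing R] {b : R}
    (hb : b ∈ R⁰) (I : Ideal R) (hbI : b ∈ I) (p : Ideal R) [p.IsPrime] (hIp : I ≤ p)
    (hp : p.height ≤ 1) : p ∈ I.minimalPrimes := by
  obtain ⟨q, hq, hqp⟩ := Ideal.exists_minimalPrimes_le hIp
  have := hq.isPrime
  rcases hqp.lt_or_eq with hlt | rfl
  · have h1 := one_le_height_of_mem_nonZeroDivisors hb q (hq.1.2 hbI)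
    have h2 := Ideal.height_add_one_le_of_lt_of_isPrime hlt
    have h3 : (1 + 1 : ℕ∞) ≤ 1 := (add_le_add_left h1 1).trans (h2.trans hp)
    norm_num at h3
  · exact hq

open nonZeroDivisors in
/-- If `J` contains a nonzerodivisor `b` and lies in no associated prime of `R ⧸ (b)`, then every
prime containing `J` has height at least two. -/
theorem two_le_height {R : Type u} [CommRing R] [IsNoetherianRing R] {b : R} (hb : b ∈ R⁰)
    (J : Ideal R) (hbJ : b ∈ J)
    (hJ : ∀ p ∈ associatedPrimes R (R ⧸ Ideal.span {b}), ¬ J ≤ p)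
    (p : Ideal R) [p.IsPrime] (hJp : J ≤ p) : 2 ≤ p.height := by
  by_contra! h
  have h1 : p.height ≤ 1 := Order.le_of_lt_add_one (by simpa [one_add_one_eq_two] using h)
  have := mem_minimalPrimes_of_height_le_one hb (Ideal.span {b})
    (Ideal.mem_span_singleton_self b) p (by simpa using hJp hbJ) h1
  exact hJ p (Module.associatedPrimes.minimalPrimes_annihilator_subset_associatedPrimes
      R _ (by rwa [Ideal.annihilator_quotient])) hJp

/-! ### Maximal minors -/

/-- The linear form on `R ^ (m + 1)` sending `w` to the determinant of the matrix with rows `w` and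
the `m` vectors `c`; its values on the standard basis are the signed maximal minors of `c`. -/
noncomputable def minorForm {R : Type u} [CommRing R] {m : ℕ} (c : Fin m → Fin (m + 1) → R) :
    (Fin (m + 1) → R) →ₗ[R] R :=
  Matrix.detRowAlternating.toMultilinearMap.toLinearMap (Fin.cons 0 c) 0

theorem minorForm_apply {R : Type u} [CommRing R] {m : ℕ} (c : Fin m → Fin (m + 1) → R)
    (w : Fin (m + 1) → R) :
    minorForm c w = Matrix.det (Matrix.of (Fin.cons w c : Fin (m + 1) → Fin (m + 1) → R)) := by
  rw [minorForm, MultilinearMap.toLinearMap_apply, Fin.update_cons_zero]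
  rfl

theorem minorForm_self {R : Type u} [CommRing R] {m : ℕ} (c : Fin m → Fin (m + 1) → R)
    (j : Fin m) : minorForm c (c j) = 0 := by
  rw [minorForm_apply]
  exact Matrix.det_zero_of_row_eq (Fin.succ_ne_zero j).symm (by
    change (Fin.cons (c j) c : Fin (m + 1) → Fin (m + 1) → R) 0 =
      (Fin.cons (c j) c : Fin (m + 1) → Fin (m + 1) → R) j.succ
    rw [Fin.cons_zero, Fin.cons_succ])

theorem minorForm_eq_zero_of_mem_span {R : Type u} [CommRing R] {m : ℕ}
    (c : Fin m → Fin (m + 1) → R) {w : Fin (m + 1) → R}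
    (hw : w ∈ Submodule.span R (Set.range c)) : minorForm c w = 0 := by
  have : Submodule.span R (Set.range c) ≤ LinearMap.ker (minorForm c) := by
    rw [Submodule.span_le]
    rintro _ ⟨j, rfl⟩
    exact minorForm_self c j
  exact this hw

theorem minorForm_map {R S : Type u} [CommRing R] [CommRing S] (f : R →+* S) {m : ℕ}
    (c : Fin m → Fin (m + 1) → R) (w : Fin (m + 1) → R) :
    minorForm (fun j i => f (c j i)) (fun i => f (w i)) = f (minorForm c w) := by
  rw [minorForm_apply, minorForm_apply, RingHom.map_det]
  congr 1
  ext i k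
  refine Fin.cases ?_ (fun j => ?_) i <;> simp

/-- The `m` independent vectors extend to a basis of K^(m+1), whose determinant is a value of the
form; a nonzero form is nonzero on some standard basis vector. -/
theorem exists_minorForm_ne_zero {K : Type u} [Field K] {m : ℕ} (c : Fin m → Fin (m + 1) → K)
    (hc : LinearIndependent K c) : ∃ i, minorForm c (Pi.single i 1) ≠ 0 := by
  obtain ⟨x, hx⟩ := exists_linearIndependent_cons_of_lt_finrank hc
    (by simp : m < Module.finrank K (Fin (m + 1) → K))
  have hdet : minorForm c x ≠ 0 := by
    rw [minorForm_apply]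
    have : IsUnit (Matrix.of (Fin.cons x c : Fin (m + 1) → Fin (m + 1) → K)) :=
      Matrix.linearIndependent_rows_iff_isUnit.mp hx
    exact ((Matrix.isUnit_iff_isUnit_det _).mp this).ne_zero
  by_contra! h
  apply hdet
  have : minorForm c = 0 := (Pi.basisFun K (Fin (m + 1))).ext (by simpa using h)
  rw [this]; rfl

/-- If the rows `c` stay independent modulo the prime `q`, some maximal minor is not in `q`. -/
theorem exists_minorForm_notMem {R : Type u} [CommRing R] {m : ℕ} (c : Fin m → Fin (m + 1) → R)
    (q : Ideal R) [q.IsPrime]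
    (h : ∀ v : Fin m → R, (∀ i, (∑ j, v j • c j) i ∈ q) → ∀ j, v j ∈ q) :
    ∃ w, minorForm c w ∉ q := by
  let D := R ⧸ q
  let K := FractionRing D
  let f : R →+* K := (algebraMap D K).comp (Ideal.Quotient.mk q)
  have hf : ∀ x, f x = 0 ↔ x ∈ q := by
    intro x
    rw [RingHom.comp_apply, map_eq_zero_iff _ (IsFractionRing.injective D K),
      Ideal.Quotient.eq_zero_iff_mem]
  have hli : LinearIndependent K (fun j i => f (c j i)) := by
    rw [← LinearIndependent.iff_fractionRing D K, Fintype.linearIndependent_iff]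
    intro v hv j
    choose v' hv' using fun j => Ideal.Quotient.mk_surjective (v j)
    rw [← hv', Ideal.Quotient.eq_zero_iff_mem]
    refine h v' (fun i => ?_) j
    rw [← hf]
    have := congrFun hv i
    simp only [Finset.sum_apply, Algebra.smul_def, Pi.zero_apply] at this
    simp only [Finset.sum_apply, Pi.smul_apply, smul_eq_mul, map_sum, map_mul]
    rw [← this]
    refine Finset.sum_congr rfl fun j _ => ?_
    rw [← hv']; rfl
  obtain ⟨i, hi⟩ := exists_minorForm_ne_zero _ hli
  refine ⟨Pi.single i 1, fun hmem => hi ?_⟩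
  rw [← (hf _).mpr hmem, ← minorForm_map]
  congr 1
  ext k
  by_cases hk : k = i
  · subst hk; simp
  · simp [Pi.single_eq_of_ne hk]

/-! ### Localization at minimal primes and the Hilbert-Burch theorem -/

/-- Over an Artinian ring, a sequence `Sᵐ → Sᵐ⁺¹ → S` exact in the middle is exact. -/
theorem exact_of_isArtinianRing {S : Type u} [CommRing S] [IsArtinianRing S] {m : ℕ}
    (f : (Fin m → S) →ₗ[S] (Fin (m + 1) → S)) (g : (Fin (m + 1) → S) →ₗ[S] S)
    (hfg : LinearMap.range f = LinearMap.ker g) :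
    Function.Injective f ∧ Function.Surjective g := by
  -- With `L` the length of `S`: m L = ker f + im f, (m+1) L = im f + im g and L = im g + coker g in
  -- lengths. As all are finite, ker f and coker g have length zero.
  have hS : Module.length S S ≠ ⊤ := Module.length_ne_top
  have h1 := Module.length_eq_add_of_exact (LinearMap.ker f).subtype f.rangeRestrict
    (Submodule.subtype_injective _) f.surjective_rangeRestrict
    (LinearMap.exact_iff.mpr (by simp))
  have h2 := Module.length_eq_add_of_exact (LinearMap.ker g).subtype g.rangeRestrict
    (Submodule.subtype_injective _) g.surjective_rangeRestrict
    (LinearMap.exact_iff.mpr (by simp))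
  have h3 := Module.length_eq_add_of_exact (LinearMap.range g).subtype (LinearMap.range g).mkQ
    (Submodule.subtype_injective _) (Submodule.mkQ_surjective _)
    (LinearMap.exact_iff.mpr (by simp))
  rw [Module.length_pi, ENat.card_eq_coe_fintype_card, Fintype.card_fin] at h1 h2
  rw [← hfg] at h2
  generalize Module.length S (LinearMap.range g) = rg at *
  generalize Module.length S (LinearMap.range f) = rf at *
  generalize Module.length S S = L at *
  have hf0 : Module.length S (LinearMap.ker f) = 0 ∧
      Module.length S (S ⧸ LinearMap.range g) = 0 := by
    generalize Module.length S (LinearMap.ker f) = kf at *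
    generalize Module.length S (S ⧸ LinearMap.range g) = q at *
    lift L to ℕ using hS
    have hmL : (m : ℕ∞) * (L : ℕ∞) ≠ ⊤ := by exact_mod_cast ENat.natCast_ne_top (m * L)
    have ha := h1 ▸ hmL
    have hb := h3 ▸ ENat.natCast_ne_top L
    rw [Ne, ENat.add_eq_top, not_or] at ha hb
    lift kf to ℕ using ha.1
    lift rf to ℕ using ha.2
    lift rg to ℕ using hb.1
    lift q to ℕ using hb.2
    norm_cast at h1 h2 h3 ⊢
    rw [add_mul] at h2
    omega
  constructor
  · rw [← LinearMap.ker_eq_bot, ← Submodule.subsingleton_iff_eq_bot]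
    exact Module.length_eq_zero_iff.mp hf0.1
  · rw [← LinearMap.range_eq_top, ← Submodule.Quotient.subsingleton_iff]
    exact Module.length_eq_zero_iff.mp hf0.2

/-- The relation module of `g` localizes. -/
theorem ker_linearCombination_le_span_localization {R : Type u} [CommRing R] (p : Ideal R)
    [p.IsPrime] {m n : ℕ} (c : Fin m → Fin n → R) (g : Fin n → R)
    (h : ∀ w : Fin n → R, ∑ i, w i * g i = 0 → w ∈ Submodule.span R (Set.range c))
    (w : Fin n → Localization.AtPrime p)
    (hw : ∑ i, w i * algebraMap R (Localization.AtPrime p) (g i) = 0) :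
    w ∈ Submodule.span (Localization.AtPrime p)
      (Set.range fun j i => algebraMap R (Localization.AtPrime p) (c j i)) := by
  let S := Localization.AtPrime p
  obtain ⟨t, ht⟩ := IsLocalization.exist_integer_multiples_of_finite p.primeCompl w
  choose w' hw' using ht
  have h0 : algebraMap R S (∑ i, w' i * g i) = 0 := by
    simp only [map_sum, map_mul, S, hw', Algebra.smul_mul_assoc, ← Finset.smul_sum, hw, smul_zero]
  -- After denominators are cleared by `t`, the relation holds only in the localization; the factor
  -- `s` makes it hold in `R`.
  obtain ⟨s, hs⟩ := (IsLocalization.map_eq_zero_iff p.primeCompl S _).mp h0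
  have h1 : (s : R) • w' ∈ Submodule.span R (Set.range c) := by
    apply h
    simpa [Finset.mul_sum, mul_assoc] using hs
  obtain ⟨r, hr⟩ := (Submodule.mem_span_range_iff_exists_fun R).mp h1
  have h2 : algebraMap R S (s * t) • w ∈ Submodule.span S
      (Set.range fun j i => algebraMap R S (c j i)) := by
    rw [Submodule.mem_span_range_iff_exists_fun]
    refine ⟨fun j => algebraMap R S (r j), ?_⟩
    ext i
    have := congrArg (algebraMap R S) (congrFun hr i)
    simp only [Finset.sum_apply, Pi.smul_apply, smul_eq_mul, map_sum, map_mul, hw', S] at this ⊢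
    rw [this, Algebra.smul_def, mul_assoc]
  have hu : IsUnit (algebraMap R S (s * t)) :=
    IsLocalization.map_units S (⟨s * t, (s * t).2⟩ : p.primeCompl)
  obtain ⟨u, hu⟩ := hu
  rw [← hu] at h2
  simpa [smul_smul] using Submodule.smul_mem _ (↑u⁻¹ : S) h2

section

open nonZeroDivisors

variable {R : Type u} [CommRing R] [IsNoetherianRing R] {m : ℕ} (c : Fin m → Fin (m + 1) → R)
  (g : Fin (m + 1) → R)

/-- If a module with a presentation by `m` relations on `m + 1` generators is an ideal, then it is
not contained in a minimal prime `p`, and the relations are independent at `p`. -/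
theorem localization_of_height_eq_zero
    (h : ∀ w : Fin (m + 1) → R, ∑ i, w i * g i = 0 ↔ w ∈ Submodule.span R (Set.range c))
    (p : Ideal R) [p.IsPrime] (hp : p.height = 0) :
    (∃ i, g i ∉ p) ∧ ∀ v : Fin m → R, ∑ j, v j • c j = 0 → ∀ j, ∃ s ∉ p, s * v j = 0 := by
  let S := Localization.AtPrime p
  have hart : IsArtinianRing S := by
    have : Ring.KrullDimLE 0 S := by
      rw [ringKrullDimZero_iff_ringKrullDim_eq_zero,
        IsLocalization.AtPrime.ringKrullDim_eq_height p S, hp]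
      rfl
    have : IsNoetherianRing S := IsLocalization.isNoetherianRing p.primeCompl S inferInstance
    exact isArtinianRing_iff_isNoetherianRing_krullDimLE_zero.mpr ⟨this, ‹_›⟩
  let c' : Fin m → Fin (m + 1) → S := fun j i => algebraMap R S (c j i)
  let g' : Fin (m + 1) → S := fun i => algebraMap R S (g i)
  have hmem : ∀ j, ∑ i, c j i * g i = 0 := fun j => (h _).mpr (Submodule.subset_span ⟨j, rfl⟩)
  have hex : LinearMap.range (Fintype.linearCombination S c') =
      LinearMap.ker (Fintype.linearCombination S g') := by
    rw [Fintype.range_linearCombination]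
    apply le_antisymm
    · rw [Submodule.span_le]
      rintro _ ⟨j, rfl⟩
      have := congrArg (algebraMap R S) (hmem j)
      simpa [Fintype.linearCombination_apply, c', g'] using this
    · intro w hw
      refine ker_linearCombination_le_span_localization p c g (fun w => (h w).mp) w ?_
      simpa [Fintype.linearCombination_apply, g'] using hw
  obtain ⟨hinj, hsurj⟩ := exact_of_isArtinianRing _ _ hex
  constructor
  · by_contra! hall
    obtain ⟨w, hw⟩ := hsurj 1
    have : (1 : S) ∈ IsLocalRing.maximalIdeal S := by
      rw [← hw, Fintype.linearCombination_apply]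
      refine Ideal.sum_mem _ fun i _ => Ideal.mul_mem_left _ _ ?_
      rw [← Localization.AtPrime.map_eq_maximalIdeal]
      exact Ideal.mem_map_of_mem _ (hall i)
    exact (IsLocalRing.maximalIdeal.isMaximal S).ne_top ((Ideal.eq_top_iff_one _).mpr this)
  · intro v hv j
    have : (fun j => algebraMap R S (v j)) = 0 := by
      apply hinj
      rw [map_zero, Fintype.linearCombination_apply]
      ext i
      have := congrArg (algebraMap R S) (congrFun hv i)
      simpa [c', Algebra.smul_def] using this
    obtain ⟨s, hs⟩ := (IsLocalization.map_eq_zero_iff p.primeCompl S _).mp (congrFun this j)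
    exact ⟨s, s.2, hs⟩

/-- The annihilator of a nonzero coefficient lies in an associated prime `p`. That prime has height
zero, so the coefficient is killed by an element outside `p`. -/
theorem linearIndependent_relations
    (h : ∀ w : Fin (m + 1) → R, ∑ i, w i * g i = 0 ↔ w ∈ Submodule.span R (Set.range c))
    (hR : ∀ p ∈ associatedPrimes R R, p.height = 0) : LinearIndependent R c := by
  rw [Fintype.linearIndependent_iff]
  intro v hv j
  by_contra hj
  obtain ⟨p, hp, hle⟩ := exists_le_isAssociatedPrime_of_isNoetherianRing R (v j) hj
  have := hp.isPrime
  obtain ⟨s, hs, hsv⟩ := (localization_of_height_eq_zero c g h p (hR p hp)).2 v hv j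
  exact hs (hle (by simpa [Submodule.mem_colon_singleton] using hsv))

/-- Otherwise prime avoidance puts the ideal inside an associated prime, which has height zero. -/
theorem exists_nonZeroDivisor_mem_span
    (h : ∀ w : Fin (m + 1) → R, ∑ i, w i * g i = 0 ↔ w ∈ Submodule.span R (Set.range c))
    (hR : ∀ p ∈ associatedPrimes R R, p.height = 0) : ∃ w : Fin (m + 1) → R, ∑ i, w i * g i ∈ R⁰ := by
  by_contra! hcon
  obtain ⟨p, hp, hle⟩ := ((Ideal.span (Set.range g)).subset_union_prime_finite
    (associatedPrimes.finite R R) (f := id) ⊥ ⊥ (fun _ h _ _ => h.isPrime)).1 <| by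
      simp_rw [id, biUnion_associatedPrimes_eq_compl_nonZeroDivisors]
      intro x hx
      obtain ⟨w, rfl⟩ := (Submodule.mem_span_range_iff_exists_fun R).mp hx
      exact hcon w
  have := hp.isPrime
  obtain ⟨i, hi⟩ := (localization_of_height_eq_zero c g h p (hR p hp)).1
  exact hi (hle (Ideal.subset_span ⟨i, rfl⟩))

/-- The maximal minors of `c` are not contained in an associated prime of `R ⧸ (b)`. -/
theorem exists_minorForm_notMem_of_mem_associatedPrimes
    (h : ∀ w : Fin (m + 1) → R, ∑ i, w i * g i = 0 ↔ w ∈ Submodule.span R (Set.range c))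
    (hc : LinearIndependent R c) {b : R} (hb : b ∈ R⁰) (q : Ideal R)
    (hq : q ∈ associatedPrimes R (R ⧸ Ideal.span {b})) : ∃ w, minorForm c w ∉ q := by
  obtain ⟨hqp, y, hy⟩ := isAssociatedPrime_iff.mp hq
  obtain ⟨s, rfl⟩ := Ideal.Quotient.mk_surjective y
  have hmem : ∀ a, a ∈ q ↔ b ∣ a * s := by
    intro a
    rw [hy, Submodule.mem_colon_singleton, Submodule.mem_bot, ← Ideal.mem_span_singleton,
      ← Ideal.Quotient.eq_zero_iff_mem, map_mul]
    rfl
  refine exists_minorForm_notMem c q fun v hv j => ?_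
  -- The aim is that `c` stays injective modulo `b`. Here `b w` is the combination of the `c j` with
  -- coefficients `s * v j`; as `b` is a nonzerodivisor, `w` is itself a relation, with coefficients
  -- `u`, and independence gives `s * v j = b * u j`.
  choose w hw using fun i => (hmem _).mp (hv i)
  have hw' : b • w = ∑ j, (s * v j) • c j := by
    ext i
    rw [Pi.smul_apply, smul_eq_mul, ← hw i]
    simp only [Finset.sum_apply, Pi.smul_apply, smul_eq_mul, Finset.sum_mul]
    exact Finset.sum_congr rfl fun j _ => by ring
  have hbw : ∑ i, (b • w) i * g i = 0 := by
    rw [h, hw', Submodule.mem_span_range_iff_exists_fun]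
    exact ⟨_, rfl⟩
  have hgw : ∑ i, w i * g i = 0 := by
    refine (mem_nonZeroDivisors_iff.mp hb).1 _ ?_
    rw [← hbw, Finset.mul_sum]
    exact Finset.sum_congr rfl fun i _ => by simp [mul_assoc]
  obtain ⟨u, hu⟩ := (Submodule.mem_span_range_iff_exists_fun R).mp ((h w).mp hgw)
  have := Fintype.linearIndependent_iff.mp hc (fun j => s * v j - b * u j) (by
    simp only [sub_smul, Finset.sum_sub_distrib]
    rw [← hw', ← hu, Finset.smul_sum]
    simp only [mul_smul, sub_self])
  rw [hmem]
  exact ⟨u j, by rw [mul_comm]; exact sub_eq_zero.mp (this j)⟩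

/-- The maximal minors of `c` are not contained in an associated prime of `R`. -/
theorem exists_minorForm_notMem_of_mem_associatedPrimes_self
    (hc : LinearIndependent R c) (q : Ideal R) (hq : q ∈ associatedPrimes R R) :
    ∃ w, minorForm c w ∉ q := by
  obtain ⟨hqp, s, hs⟩ := isAssociatedPrime_iff.mp hq
  have hmem : ∀ a, a ∈ q ↔ a * s = 0 := by
    intro a
    rw [hs, Submodule.mem_colon_singleton, Submodule.mem_bot, smul_eq_mul]
  refine exists_minorForm_notMem c q fun v hv j => ?_
  rw [hmem, mul_comm]
  refine Fintype.linearIndependent_iff.mp hc (fun j => s * v j) ?_ j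
  ext i
  have := (hmem _).mp (hv i)
  simp only [Finset.sum_apply, Pi.smul_apply, smul_eq_mul, Finset.sum_mul, Pi.zero_apply] at this ⊢
  rw [← this]
  exact Finset.sum_congr rfl fun j _ => by ring

/-- The Hilbert-Burch theorem: if the independent vectors `c` generate the relations on `g` and the
ideal generated by `g` contains a nonzerodivisor, then `g` is, up to a nonzerodivisor factor, given
by the maximal minors of `c`. -/
theorem hilbertBurch
    (h : ∀ w : Fin (m + 1) → R, ∑ i, w i * g i = 0 ↔ w ∈ Submodule.span R (Set.range c))
    (hc : LinearIndependent R c) (hg : ∃ w : Fin (m + 1) → R, ∑ i, w i * g i ∈ R⁰) :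
    ∃ a ∈ R⁰, (∀ w, ∑ i, w i * g i = a * minorForm c w) ∧ ∃ w, minorForm c w ∈ R⁰ := by
  obtain ⟨w₁, hw₁⟩ : ∃ w, minorForm c w ∈ R⁰ := by
    by_contra! hcon
    obtain ⟨p, hp, hle⟩ := (Ideal.subset_union_prime_finite (I := LinearMap.range (minorForm c))
      (associatedPrimes.finite R R) (f := id) ⊥ ⊥ (fun _ h _ _ => h.isPrime)).1 <| by
        simp_rw [id, biUnion_associatedPrimes_eq_compl_nonZeroDivisors]
        rintro _ ⟨w, rfl⟩
        exact hcon w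
    obtain ⟨w, hw⟩ := exists_minorForm_notMem_of_mem_associatedPrimes_self c hc p hp
    exact hw (hle ⟨w, rfl⟩)
  obtain ⟨w₀, hw₀⟩ := hg
  -- Writing g(w) for `∑ i, w i * g i`, the vector g(w') w - g(w) w' is a relation on `g`, so the
  -- minor form kills it: the two forms are proportional.
  have hlin : ∀ w w', (∑ i, w' i * g i) * minorForm c w = minorForm c w' * ∑ i, w i * g i := by
    intro w w'
    have h0 : minorForm c ((∑ i, w' i * g i) • w - (∑ i, w i * g i) • w') = 0 := by
      apply minorForm_eq_zero_of_mem_span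
      rw [← h]
      simp only [Pi.sub_apply, Pi.smul_apply, smul_eq_mul, sub_mul, Finset.sum_sub_distrib,
        mul_assoc, ← Finset.mul_sum]
      ring
    rw [map_sub, map_smul, map_smul, smul_eq_mul, smul_eq_mul, sub_eq_zero] at h0
    rw [h0, mul_comm]
  have hy : minorForm c w₀ ∈ R⁰ := by
    have : minorForm c w₀ * ∑ i, w₁ i * g i ∈ R⁰ := hlin w₁ w₀ ▸ mul_mem hw₀ hw₁
    exact (mul_mem_nonZeroDivisors.mp this).1
  -- By proportionality every minor kills the class of the right side modulo `minorForm c w₀`. Were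
  -- it nonzero, all minors would lie in one associated prime of that quotient.
  obtain ⟨a, ha⟩ : minorForm c w₀ ∣ ∑ i, w₀ i * g i := by
    rw [← Ideal.mem_span_singleton, ← Ideal.Quotient.eq_zero_iff_mem]
    by_contra hne
    obtain ⟨q, hq, hle⟩ := exists_le_isAssociatedPrime_of_isNoetherianRing R _ hne
    obtain ⟨w, hw⟩ := exists_minorForm_notMem_of_mem_associatedPrimes c g h hc hy q hq
    apply hw
    apply hle
    rw [Submodule.mem_colon_singleton, Submodule.mem_bot]
    change Ideal.Quotient.mk _ (minorForm c w * _) = 0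
    rw [mul_comm, hlin, Ideal.Quotient.eq_zero_iff_mem]
    exact Ideal.mul_mem_right _ _ (Ideal.mem_span_singleton_self _)
  refine ⟨a, (mul_mem_nonZeroDivisors.mp (ha ▸ hw₀)).2, fun w => ?_, w₁, hw₁⟩
  refine (isLeftRegular_iff_mem_nonZeroDivisorsLeft.mpr ?_ : IsLeftRegular (minorForm c w₀)) ?_
  · exact hy.1
  · change minorForm c w₀ * _ = minorForm c w₀ * _
    rw [← hlin, ha, mul_assoc]

end

/-! ### Dimension shifting for left derived functors -/

namespace CategoryTheory.ProjectiveResolution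

open Limits

variable {C : Type*} [Category* C] [Abelian C]

/-- The augmentation of a projective resolution, as a morphism to the resolved object. -/
noncomputable def augmentation {Z : C} (Q : ProjectiveResolution Z) : Q.complex.X 0 ⟶ Z := Q.π.f 0

theorem d_comp_augmentation {Z : C} (Q : ProjectiveResolution Z) :
    Q.complex.d 1 0 ≫ Q.augmentation = 0 := Q.complex_d_comp_π_f_zero

instance {Z : C} (Q : ProjectiveResolution Z) : Epi Q.augmentation :=
  inferInstanceAs (Epi (Q.π.f 0))

theorem exact_augmentation {Z : C} (Q : ProjectiveResolution Z) :
    (ShortComplex.mk _ _ Q.d_comp_augmentation).Exact := Q.exact₀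

/-- Splicing a projective resolution of the kernel of `g : P ⟶ X` with `P` projective. -/
noncomputable def splice {S : ShortComplex C} (hS : S.ShortExact) [Projective S.X₂]
    (Q : ProjectiveResolution S.X₁) : ProjectiveResolution S.X₃ where
  complex := ChainComplex.augment Q.complex (Q.augmentation ≫ S.f) (by
    rw [← Category.assoc, Q.d_comp_augmentation, zero_comp])
  projective n := by
    cases n with
    | zero => exact ‹Projective S.X₂›
    | succ n => exact Q.projective n
  π := (ChainComplex.toSingle₀Equiv _ _).symm ⟨S.g, by
    change (Q.augmentation ≫ S.f) ≫ S.g = 0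
    rw [Category.assoc, S.zero, comp_zero]⟩
  quasiIso := ⟨fun n => by
    have := hS.mono_f
    rcases n with _ | _ | n
    · rw [ChainComplex.quasiIsoAt₀_iff, ShortComplex.quasiIso_iff_of_zeros' _ rfl rfl rfl]
      have key (k : S.X₂ ⟶ S.X₃) (hk : k = S.g) (w : (Q.augmentation ≫ S.f) ≫ k = 0) :
          (ShortComplex.mk _ _ w).Exact ∧ Epi k := by
        subst hk
        let φ : ShortComplex.mk _ _ w ⟶ S := { τ₁ := Q.augmentation, τ₂ := 𝟙 _, τ₃ := 𝟙 _ }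
        have : Epi φ.τ₁ := inferInstanceAs (Epi Q.augmentation)
        have : IsIso φ.τ₂ := inferInstanceAs (IsIso (𝟙 _))
        have : Mono φ.τ₃ := inferInstanceAs (Mono (𝟙 _))
        exact ⟨(ShortComplex.exact_iff_of_epi_of_isIso_of_mono φ).2 hS.exact, hS.epi_g⟩
      exact key _ (ChainComplex.toSingle₀Equiv_symm_apply_f_zero _ _) _
    · rw [quasiIsoAt_iff_exactAt' _ _ (ChainComplex.exactAt_succ_single_obj _ _)]
      rw [HomologicalComplex.exactAt_iff' _ 2 1 0 (by simp) (by simp)]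
      let S' : ShortComplex C := ShortComplex.mk (Q.complex.d 1 0) (Q.augmentation ≫ S.f) (by
        rw [← Category.assoc, Q.d_comp_augmentation, zero_comp])
      have : S'.Exact := by
        let φ : ShortComplex.mk _ _ Q.d_comp_augmentation ⟶ S' :=
          { τ₁ := 𝟙 _, τ₂ := 𝟙 _, τ₃ := S.f }
        have : Epi φ.τ₁ := inferInstanceAs (Epi (𝟙 _))
        have : IsIso φ.τ₂ := inferInstanceAs (IsIso (𝟙 _))
        have : Mono φ.τ₃ := inferInstanceAs (Mono S.f)
        exact (ShortComplex.exact_iff_of_epi_of_isIso_of_mono φ).1 Q.exact_augmentation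
      exact this
    · rw [quasiIsoAt_iff_exactAt' _ _ (ChainComplex.exactAt_succ_single_obj _ _)]
      rw [HomologicalComplex.exactAt_iff' _ (n + 3) (n + 2) (n + 1) (by simp) (by simp)]
      exact Q.exact_succ n⟩

/-- The augmentation of a projective resolution is a cokernel of the last differential. -/
noncomputable def isColimitAugmentation {Z : C} (Q : ProjectiveResolution Z) :
    IsColimit (CokernelCofork.ofπ _ Q.d_comp_augmentation) :=
  Q.exact_augmentation.gIsCokernel

/-- Dimension shifting for left derived functors, in the minimal case. -/
noncomputable def leftDerivedOneIso {D : Type*} [Category* D] [Abelian D]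
    [HasProjectiveResolutions C]
    (F : C ⥤ D) [F.Additive] [PreservesFiniteColimits F]
    {S : ShortComplex C} (hS : S.ShortExact) [Projective S.X₂] (hF : F.map S.f = 0) :
    (F.leftDerived 1).obj S.X₃ ≅ F.obj S.X₁ := by
  let Q := projectiveResolution S.X₁
  refine (splice hS Q).isoLeftDerivedObj F 1 ≪≫ ?_
  let K := (F.mapHomologicalComplex _).obj (splice hS Q).complex
  let S' : ShortComplex D := K.sc' 2 1 0
  -- The outgoing differential dies under `F`, so the first homology is the cokernel of the incoming
  -- one, which is `F.obj S.X₁` by right exactness.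
  have hg : S'.g = 0 := by
    change F.map (Q.augmentation ≫ S.f) = 0
    rw [F.map_comp, hF, comp_zero]
  have w : S'.f ≫ F.map Q.augmentation = 0 := by
    change F.map (Q.complex.d 1 0) ≫ F.map Q.augmentation = 0
    rw [← F.map_comp, Q.d_comp_augmentation, F.map_zero]
  have hc : IsColimit (CokernelCofork.ofπ (f := S'.f) (F.map Q.augmentation) w) :=
    CokernelCofork.mapIsColimit _ Q.isColimitAugmentation F
  exact ShortComplex.homologyMapIso (K.isoSc' 2 1 0 (by simp) (by simp)) ≪≫
    (ShortComplex.LeftHomologyData.ofIsColimitCokernelCofork S' hg _ hc).homologyIso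

end CategoryTheory.ProjectiveResolution

/-! ### Betti numbers as numbers of generators and relations -/

theorem finrank_extendScalars_residue {R : Type u} [CommRing R] [IsLocalRing R]
    (N : Type u) [AddCommGroup N] [Module R N] [Module.Finite R N] :
    Module.finrank (IsLocalRing.ResidueField R)
      ((ModuleCat.extendScalars.{u, u, u} (IsLocalRing.residue R)).obj (ModuleCat.of R N)) =
    (⊤ : Submodule R N).spanFinrank := by
  have h := TensorProduct.spanFinrank_top_eq_of_residueField (⊤ : Submodule R N) Module.Finite.fg_top
  rw [← h, ← Module.finrank_eq_spanFinrank_of_free]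
  have e : (TensorProduct R (IsLocalRing.ResidueField R) (⊤ : Submodule R N)) ≃ₗ[IsLocalRing.ResidueField R] (TensorProduct R (IsLocalRing.ResidueField R) N) :=
    Submodule.topEquiv.baseChange R _ _ _
  rw [e.finrank_eq]
  with_unfolding_all rfl

open TensorProduct in
/-- In a presentation of `N` by a free module on a minimal set of generators, the inclusion of the
relations becomes zero over the residue field. -/
theorem extendScalars_residue_map_eq_zero {R : Type u} [CommRing R] [IsLocalRing R]
    {S : ShortComplex (ModuleCat.{u} R)} (hS : S.ShortExact) [Module.Finite R S.X₂]
    [Module.Finite R S.X₃]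
    (h : (⊤ : Submodule R S.X₃).spanFinrank = (⊤ : Submodule R S.X₂).spanFinrank) :
    (ModuleCat.extendScalars.{u, u, u} (IsLocalRing.residue R)).map S.f = 0 := by
  let F := ModuleCat.extendScalars.{u, u, u} (IsLocalRing.residue R)
  have := hS.epi_g
  have hs : Function.Surjective (F.map S.g).hom := (ModuleCat.epi_iff_surjective _).1 inferInstance
  have : Module.Finite (IsLocalRing.ResidueField R) (F.obj S.X₂) :=
    inferInstanceAs (Module.Finite (IsLocalRing.ResidueField R) ((IsLocalRing.ResidueField R) ⊗[R] S.X₂))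
  have : Module.Finite (IsLocalRing.ResidueField R) (F.obj S.X₃) :=
    inferInstanceAs (Module.Finite (IsLocalRing.ResidueField R) ((IsLocalRing.ResidueField R) ⊗[R] S.X₃))
  -- A surjection between spaces of equal finite dimension is injective, so `F.map S.g` can be
  -- cancelled from the zero composite.
  have hd : Module.finrank (IsLocalRing.ResidueField R) (F.obj S.X₂) =
      Module.finrank (IsLocalRing.ResidueField R) (F.obj S.X₃) := by
    rw [finrank_extendScalars_residue S.X₂, finrank_extendScalars_residue S.X₃, h]
  have hi := (LinearMap.injective_iff_surjective_of_finrank_eq_finrank hd).2 hs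
  have : Mono (F.map S.g) := (ModuleCat.mono_iff_injective _).2 hi
  rw [← cancel_mono (F.map S.g), ← F.map_comp, S.zero, F.map_zero, Limits.zero_comp]

theorem bettiNumber_zero {R : Type u} [CommRing R] [IsLocalRing R]
    (N : Type u) [AddCommGroup N] [Module R N] [Module.Finite R N] :
    bettiNumber R N 0 = (⊤ : Submodule R N).spanFinrank := by
  rw [← finrank_extendScalars_residue N]
  exact LinearEquiv.finrank_eq
    ((ModuleCat.extendScalars.{u, u, u} (IsLocalRing.residue R)).leftDerivedZeroIsoSelf.app
      (ModuleCat.of R N)).toLinearEquiv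

/-- Minimality of the generators makes the inclusion of the syzygies vanish over the residue field
`k`, so Tor₁ is `k ⊗ S.X₁`. -/
theorem bettiNumber_one {R : Type u} [CommRing R] [IsLocalRing R]
    {S : ShortComplex (ModuleCat.{u} R)} (hS : S.ShortExact) [Projective S.X₂]
    [Module.Finite R S.X₁] [Module.Finite R S.X₂] [Module.Finite R S.X₃]
    (h : (⊤ : Submodule R S.X₃).spanFinrank = (⊤ : Submodule R S.X₂).spanFinrank) :
    bettiNumber R S.X₃ 1 = (⊤ : Submodule R S.X₁).spanFinrank := by
  rw [← finrank_extendScalars_residue S.X₁]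
  have : Limits.PreservesFiniteColimits
    (ModuleCat.extendScalars.{u, u, u} (IsLocalRing.residue R)) := inferInstance
  exact LinearEquiv.finrank_eq (ProjectiveResolution.leftDerivedOneIso _ hS
    (extendScalars_residue_map_eq_zero hS h)).toLinearEquiv

theorem bettiNumber_one_of_projective {R : Type u} [CommRing R] [IsLocalRing R]
    (N : Type u) [AddCommGroup N] [Module R N] [Module.Projective R N] :
    bettiNumber R N 1 = 0 := by
  have h := Functor.isZero_leftDerived_obj_projective_succ
    (ModuleCat.extendScalars.{u, u, u} (IsLocalRing.residue R)) 0 (ModuleCat.of R N)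
  have := ModuleCat.subsingleton_of_isZero h
  exact Module.finrank_zero_of_subsingleton

section

theorem ModuleCat.shortExact_of_exact {R A B C : Type u} [CommRing R] [AddCommGroup A] [Module R A]
    [AddCommGroup B] [Module R B] [AddCommGroup C] [Module R C] (f : A →ₗ[R] B) (g : B →ₗ[R] C)
    (hf : Function.Injective f) (hg : Function.Surjective g) (h : Function.Exact f g) :
    (ShortComplex.mk (ModuleCat.ofHom f) (ModuleCat.ofHom g)
      (by ext x; exact h.apply_apply_eq_zero x)).ShortExact where
  exact := (ShortComplex.ShortExact.moduleCat_exact_iff_function_exact _).2 h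
  mono_f := (ModuleCat.mono_iff_injective _).2 hf
  epi_g := (ModuleCat.epi_iff_surjective _).2 hg

theorem Submodule.exists_fin_span_eq_top {R N : Type*} [CommRing R] [AddCommGroup N] [Module R N]
    [Module.Finite R N] {n : ℕ} (hn : (⊤ : Submodule R N).spanFinrank = n) :
    ∃ v : Fin n → N, Submodule.span R (Set.range v) = ⊤ := by
  obtain ⟨s, hs, hspan⟩ := Submodule.FG.exists_span_finset_card_eq_spanFinrank
    (Module.Finite.fg_top (R := R) (M := N))
  let e := (s.equivFinOfCardEq (hs.trans hn)).symm
  refine ⟨fun i => e i, ?_⟩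
  rw [← hspan]
  congr 1
  ext x
  constructor
  · rintro ⟨i, rfl⟩
    exact (e i).2
  · intro hx
    exact ⟨e.symm ⟨x, hx⟩, by simp⟩

variable {R : Type u} [CommRing R]

theorem bettiNumber_one_eq_spanFinrank_ker [IsLocalRing R] [IsNoetherianRing R] {N : Type u} [AddCommGroup N] [Module R N]
    [Module.Finite R N] {n : ℕ} (hn : (⊤ : Submodule R N).spanFinrank = n) {v : Fin n → N}
    (hv : Submodule.span R (Set.range v) = ⊤) :
    bettiNumber R N 1 = (LinearMap.ker (Fintype.linearCombination R v)).spanFinrank := by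
  have hsurj : Function.Surjective (Fintype.linearCombination R v) := by
    rw [← LinearMap.range_eq_top, Fintype.range_linearCombination, hv]
  let K := LinearMap.ker (Fintype.linearCombination R v)
  let S : ShortComplex (ModuleCat.{u} R) := ShortComplex.mk (ModuleCat.ofHom K.subtype)
    (ModuleCat.ofHom (Fintype.linearCombination R v)) (by ext x; exact x.2)
  have hS : S.ShortExact := ModuleCat.shortExact_of_exact K.subtype _
    (Submodule.subtype_injective _) hsurj (LinearMap.exact_subtype_ker_map _)
  have : Projective S.X₂ := inferInstanceAs (Projective (ModuleCat.of R (Fin n → R)))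
  have : Module.Finite R S.X₁ := inferInstanceAs (Module.Finite R K)
  have : Module.Finite R S.X₂ := inferInstanceAs (Module.Finite R (Fin n → R))
  have : Module.Finite R S.X₃ := inferInstanceAs (Module.Finite R N)
  have h2 : (⊤ : Submodule R (Fin n → R)).spanFinrank = n := by
    rw [← Module.finrank_eq_spanFinrank_of_free, Module.finrank_fin_fun]
  exact (bettiNumber_one hS (hn.trans h2.symm)).trans (Submodule.spanFinrank_top K)

/-- An ideal with `m` minimal relations and `m + 1` minimal generators has a presentation by
relations of these sizes. -/
theorem exists_minimal_presentation [IsLocalRing R] [IsNoetherianRing R] (I : Ideal R) {m : ℕ} (h1 : bettiNumber R I 1 = m)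
    (h0 : bettiNumber R I 0 = m + 1) :
    ∃ (g : Fin (m + 1) → R) (c : Fin m → Fin (m + 1) → R), Ideal.span (Set.range g) = I ∧
      ∀ w : Fin (m + 1) → R, ∑ i, w i * g i = 0 ↔ w ∈ Submodule.span R (Set.range c) := by
  rw [bettiNumber_zero] at h0
  obtain ⟨v, hv⟩ := Submodule.exists_fin_span_eq_top h0
  rw [bettiNumber_one_eq_spanFinrank_ker h0 hv, ← Submodule.spanFinrank_top] at h1
  obtain ⟨w, hw⟩ := Submodule.exists_fin_span_eq_top h1
  refine ⟨fun i => v i, fun i => w i, ?_, fun x => ?_⟩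
  · have := congrArg (Submodule.map I.subtype) hv
    rwa [Submodule.map_span, ← Set.range_comp, Submodule.map_top, Submodule.range_subtype] at this
  · have := congrArg (Submodule.map (Submodule.subtype _)) hw
    rw [Submodule.map_span, ← Set.range_comp, Submodule.map_top, Submodule.range_subtype] at this
    change _ ↔ x ∈ Submodule.span R (Set.range (Subtype.val ∘ w))
    erw [this]
    rw [LinearMap.mem_ker, Fintype.linearCombination_apply, ← Subtype.val_inj]
    simp

/-- A presentation by independent relations gives a free resolution of length one. -/
theorem exists_free_resolution {I : Ideal R} {m : ℕ} {g : Fin (m + 1) → R}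
    {c : Fin m → Fin (m + 1) → R} (hg : Ideal.span (Set.range g) = I)
    (h : ∀ w : Fin (m + 1) → R, ∑ i, w i * g i = 0 ↔ w ∈ Submodule.span R (Set.range c))
    (hc : LinearIndependent R c) :
    ∃ (f : (Fin m → R) →ₗ[R] (Fin (m + 1) → R)) (φ : (Fin (m + 1) → R) →ₗ[R] I),
      Function.Injective f ∧ Function.Surjective φ ∧ Function.Exact f φ := by
  have hgI (i) : g i ∈ I := hg ▸ Ideal.subset_span ⟨i, rfl⟩
  let v : Fin (m + 1) → I := fun i => ⟨g i, hgI i⟩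
  refine ⟨Fintype.linearCombination R c, Fintype.linearCombination R v,
    linearIndependent_iff_injective_fintypeLinearCombination.1 hc, ?_, fun w => ?_⟩
  · rintro ⟨x, hx⟩
    obtain ⟨a, ha⟩ := (Ideal.mem_span_range_iff_exists_fun).1 (hg ▸ hx)
    refine ⟨a, ?_⟩
    ext
    simp [Fintype.linearCombination_apply, v, ha]
  · rw [← LinearMap.coe_range, SetLike.mem_coe, Fintype.range_linearCombination, ← h w,
      Fintype.linearCombination_apply, ← Subtype.val_inj]
    simp [v]

theorem projDim_eq_one {I : Ideal R} {m n : ℕ} {f : (Fin m → R) →ₗ[R] (Fin n → R)}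
    {φ : (Fin n → R) →ₗ[R] I} (hf : Function.Injective f) (hφ : Function.Surjective φ)
    (h : Function.Exact f φ) (hI : ¬ Module.Projective R I) : projDim R I = 1 := by
  have hS := ModuleCat.shortExact_of_exact f φ hf hφ h
  apply le_antisymm
  · exact (projectiveDimension_le_iff (ModuleCat.of R I) 1).2
      (hS.hasProjectiveDimensionLT_X₃ 1 inferInstance inferInstance)
  · refine (projectiveDimension_ge_iff (ModuleCat.of R I) 1).2 fun h => hI ?_
    rw [← projective_iff_hasProjectiveDimensionLT_one] at h
    exact (IsProjective.iff_projective (R := R) I).2 h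

theorem projDim_quotient_ne_top {I : Ideal R} (hI : projDim R I = 1) : projDim R (R ⧸ I) ≠ ⊤ := by
  have h : HasProjectiveDimensionLE (ModuleCat.of R I) 1 :=
    (projectiveDimension_le_iff (ModuleCat.of R I) 1).1 hI.le
  have hS := ModuleCat.shortExact_of_exact I.subtype I.mkQ
    (Submodule.subtype_injective _) (Submodule.mkQ_surjective _)
    (LinearMap.exact_subtype_mkQ _)
  exact (projectiveDimension_ne_top_iff _).2 ⟨2, hS.hasProjectiveDimensionLT_X₃ 2 h
    (inferInstanceAs (HasProjectiveDimensionLT (ModuleCat.of R R) 3))⟩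

end

/-! ### The ideal `aJ` for a nonunit `a` -/

section TwistedIdeal

variable {R : Type u} [CommRing R]

-- If `x'a, y'a` began a regular sequence, then `y'a · x' ∈ (x'a)` would give `x' ∈ (x'a)`; since
-- `a` is not a unit, `x' = 0`, contradicting regularity of `x'a`.
open scoped Pointwise in
theorem length_le_one_of_forall_mem_span_singleton [IsLocalRing R] {a : R}
    (ha : a ∈ IsLocalRing.maximalIdeal R) (rs : List R)
    (reg : RingTheory.Sequence.IsRegular R rs) (h : ∀ r ∈ rs, r ∈ Ideal.span {a}) :
    rs.length ≤ 1 := by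
  rcases rs with _ | ⟨x, _ | ⟨y, l⟩⟩
  · simp
  · simp
  · exfalso
    obtain ⟨x', rfl⟩ := Ideal.mem_span_singleton'.1 (h x (by simp))
    obtain ⟨y', rfl⟩ := Ideal.mem_span_singleton'.1 (h y (by simp))
    rw [RingTheory.Sequence.isRegular_cons_iff, RingTheory.Sequence.isRegular_cons_iff] at reg
    obtain ⟨hx, hy, -⟩ := reg
    have hx' : (Submodule.mkQ ((x' * a) • (⊤ : Submodule R R))) x' = 0 := by
      apply hy
      simp only [smul_zero]
      rw [← map_smul, Submodule.mkQ_apply, Submodule.Quotient.mk_eq_zero,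
        Submodule.mem_smul_pointwise_iff_exists]
      exact ⟨y', trivial, by simp only [smul_eq_mul]; ring⟩
    rw [Submodule.mkQ_apply, Submodule.Quotient.mk_eq_zero,
      Submodule.mem_smul_pointwise_iff_exists] at hx'
    obtain ⟨z, -, hz⟩ := hx'
    have hu : IsUnit (1 - a * z) := IsLocalRing.isUnit_one_sub_self_of_mem_nonunits _
      ((IsLocalRing.mem_maximalIdeal _).1 (Ideal.mul_mem_right _ _ ha))
    have hx0 : x' = 0 := hu.mul_left_eq_zero.1 (by
      rw [smul_eq_mul] at hz
      linear_combination -hz)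
    have : (1 : R) = 0 := hx (by simp [hx0])
    exact one_ne_zero this

theorem idealGrade_eq_one_of_le_span_singleton [IsLocalRing R] [IsNoetherianRing R] {a : R}
    (ha : a ∈ IsLocalRing.maximalIdeal R) (I : Ideal R) (hI : I ≤ Ideal.span {a}) {b : R}
    (hb : b ∈ nonZeroDivisors R) (hbI : b ∈ I) : idealGrade I = 1 := by
  apply le_antisymm
  · refine iSup_le fun rs => iSup_le fun reg => iSup_le fun h => ?_
    exact_mod_cast length_le_one_of_forall_mem_span_singleton ha rs reg fun r hr => hI (h r hr)
  · have hm : I ≤ IsLocalRing.maximalIdeal R :=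
      hI.trans ((Ideal.span_singleton_le_iff_mem _).2 ha)
    have reg : RingTheory.Sequence.IsRegular R [b] := by
      refine .of_isWeaklyRegular_of_mem_maximalIdeal R (by simpa using hm hbI) ?_
      exact (RingTheory.Sequence.isWeaklyRegular_singleton_iff R b).2
        (isRegular_iff_mem_nonZeroDivisors.2 hb).left
    exact le_iSup_of_le [b] (le_iSup_of_le reg (le_iSup_of_le (by simpa using hbI) (by simp)))

theorem Ideal.height_radical_eq (I : Ideal R) : I.radical.height = I.height := by
  simp only [Ideal.height, Ideal.radical_minimalPrimes]

/-- Multiplication by `a` embeds `R ⧸ J` in `R ⧸ aJ`. -/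
theorem associatedPrimes_quotient_subset_of_nonZeroDivisor {a : R} (ha : a ∈ nonZeroDivisors R)
    (J : Ideal R) : associatedPrimes R (R ⧸ J) ⊆ associatedPrimes R (R ⧸ Ideal.span {a} * J) := by
  let f : (R ⧸ J) →ₗ[R] R ⧸ Ideal.span {a} * J :=
    Submodule.liftQ J ((Submodule.mkQ (Ideal.span {a} * J)).comp (LinearMap.mulLeft R a)) fun x hx => by
      exact (Submodule.Quotient.mk_eq_zero _).2 (Ideal.mem_span_singleton_mul.2 ⟨x, hx, rfl⟩)
  refine associatedPrimes.subset_of_injective (f := f) ?_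
  rw [← LinearMap.ker_eq_bot, LinearMap.ker_eq_bot']
  intro x
  induction x using Submodule.Quotient.induction_on with | _ x
  intro hx
  have hx : a * x ∈ Ideal.span {a} * J := (Submodule.Quotient.mk_eq_zero _).1 hx
  obtain ⟨y, hy, hxy⟩ := Ideal.mem_span_singleton_mul.1 hx
  rw [Submodule.Quotient.mk_eq_zero]
  rwa [← (isRegular_iff_mem_nonZeroDivisors.2 ha).left hxy]

variable [IsGorensteinLocalRing R] {a b : R} (J : Ideal R)

/-- A minimal prime of `(a)` works: it has height 1 by Krull's theorem and contains the
nonzerodivisor `ab` of `aJ`, so it is minimal over `aJ` too. -/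
theorem exists_mem_minimalPrimes_span_singleton_mul (ha : a ∈ nonZeroDivisors R)
    (ham : a ∈ IsLocalRing.maximalIdeal R)
    (hb : b ∈ nonZeroDivisors R) (hbJ : b ∈ J) :
    ∃ p ∈ (Ideal.span {a} * J).minimalPrimes, p.height = 1 := by
  obtain ⟨p, hp, -⟩ := Ideal.exists_minimalPrimes_le
    ((Ideal.span_singleton_le_iff_mem (IsLocalRing.maximalIdeal R)).2 ham)
  have := hp.1.1
  have hle := Ideal.height_le_one_of_isPrincipal_of_mem_minimalPrimes _ p hp
  refine ⟨p, mem_minimalPrimes_of_height_le_one (mul_mem ha hb) _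
    (Ideal.mem_span_singleton_mul.2 ⟨b, hbJ, rfl⟩) p (Ideal.mul_le_left.trans hp.1.2) hle,
    le_antisymm hle (one_le_height_of_mem_nonZeroDivisors ha p (hp.1.2 (by simp)))⟩

theorem height_span_singleton_mul_eq_one (ha : a ∈ nonZeroDivisors R) (ham : a ∈ IsLocalRing.maximalIdeal R)
    (hb : b ∈ nonZeroDivisors R) (hbJ : b ∈ J) : (Ideal.span {a} * J).height = 1 := by
  obtain ⟨p, hp, hp1⟩ := exists_mem_minimalPrimes_span_singleton_mul J ha ham hb hbJ
  apply le_antisymm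
  · exact hp1 ▸ Ideal.height_mono hp.1.2
  · rw [Ideal.height_eq_inf_minimalPrimes]
    refine le_iInf₂ fun q hq => ?_
    have := hq.1.1
    exact one_le_height_of_mem_nonZeroDivisors (mul_mem ha hb) q
      (hq.1.2 (Ideal.mem_span_singleton_mul.2 ⟨b, hbJ, rfl⟩))

/-- The height-one minimal primes come from `a`; the associated primes of `R ⧸ J`, of height at
least 2, also occur. -/
theorem not_isUnmixedIdeal_span_singleton_mul (ha : a ∈ nonZeroDivisors R) (ham : a ∈ IsLocalRing.maximalIdeal R)
    (hb : b ∈ nonZeroDivisors R) (hbJ : b ∈ J) (hJ : J ≠ ⊤)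
    (hbq : ∀ p ∈ associatedPrimes R (R ⧸ Ideal.span {b}), ¬ J ≤ p) :
    ¬ IsUnmixedIdeal (Ideal.span {a} * J) := by
  intro h
  obtain ⟨p, hp, hp1⟩ := exists_mem_minimalPrimes_span_singleton_mul J ha ham hb hbJ
  have : Nontrivial (R ⧸ J) := Ideal.Quotient.nontrivial_iff.2 hJ
  obtain ⟨q, hq⟩ := associatedPrimes.nonempty R (R ⧸ J)
  have := hq.1
  have hJq : J ≤ q := by
    have := IsAssociatedPrime.annihilator_le hq
    rwa [Submodule.annihilator_top, Ideal.annihilator_quotient] at this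
  have h2 := two_le_height hb J hbJ hbq q hJq
  rw [← h p (Module.associatedPrimes.minimalPrimes_annihilator_subset_associatedPrimes R _
      (by rwa [Ideal.annihilator_quotient])) q
    (associatedPrimes_quotient_subset_of_nonZeroDivisor ha J hq), hp1] at h2
  exact absurd h2 (by decide)

/-- If `y ∉ (a)`, its annihilator modulo `(a)` lies in an associated prime `p`, of height 1 by
unmixedness of `(a)`. An `s ∉ p` in all components of `aJ` except the `p`-primary one would satisfy
`sy ∈ aJ ⊆ (a)` if `y` were in the unmixed part. Conversely, the radical of a height-one component
cannot contain `J`, so the component contains `a`. -/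
theorem unmixedPart_eq_span_singleton (ha : a ∈ nonZeroDivisors R)
    (ham : a ∈ IsLocalRing.maximalIdeal R) (hb : b ∈ nonZeroDivisors R) (hbJ : b ∈ J)
    (hbq : ∀ p ∈ associatedPrimes R (R ⧸ Ideal.span {b}), ¬ J ≤ p) :
    unmixedPart (Ideal.span {a} * J) = Ideal.span {a} := by
  have hI1 := height_span_singleton_mul_eq_one J ha ham hb hbJ
  apply le_antisymm
  · intro y hy
    by_contra hya
    obtain ⟨p, hp, hyp⟩ := exists_le_isAssociatedPrime_of_isNoetherianRing R
      (Submodule.Quotient.mk y : R ⧸ Ideal.span {a})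
      (by rwa [Ne, Submodule.Quotient.mk_eq_zero])
    have := hp.1
    have hap : Ideal.span {a} ≤ p := by
      have := IsAssociatedPrime.annihilator_le hp
      rwa [Submodule.annihilator_top, Ideal.annihilator_quotient] at this
    have hp1 : p.height = 1 := le_antisymm (height_le_one_of_mem_associatedPrimes ha p hp)
      (one_le_height_of_mem_nonZeroDivisors ha p (hap (by simp)))
    have hpI := mem_minimalPrimes_of_height_le_one (mul_mem ha hb) _
      (Ideal.mem_span_singleton_mul.2 ⟨b, hbJ, rfl⟩) p
      (Ideal.mul_le_left.trans hap) hp1.le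
    obtain ⟨t, ht⟩ := Submodule.IsLasker.exists_isMinimalPrimaryDecomposition
      (Submodule.isLasker R R) (Ideal.span {a} * J)
    obtain ⟨q, hqt, rfl⟩ := Ideal.IsMinimalPrimaryDecomposition.minimalPrimes_subset_image_radical
      ht hpI
    have hyq : y ∈ q := Submodule.mem_sInf.1 hy q
      ⟨by rw [hI1, ← Ideal.height_radical_eq, hp1], t, ht, hqt⟩
    -- Another component inside the minimal prime `q.radical` would have the same radical, contrary
    -- to minimality of the decomposition.
    have hne : ¬ (t.erase q).inf id ≤ q.radical := by
      rw [Ideal.IsPrime.inf_le' this]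
      rintro ⟨(q' : Ideal R), hq', hle⟩
      rw [Finset.mem_erase] at hq'
      have hle' : q'.radical ≤ q.radical := Ideal.radical_le_radical_iff.2 hle
      refine ht.distinct hqt hq'.2 hq'.1.symm ?_
      change (q.colon Set.univ).radical = (q'.colon Set.univ).radical
      rw [Submodule.colon_univ, Submodule.colon_univ]
      exact le_antisymm (hpI.2 ⟨Ideal.isPrime_radical (ht.primary hq'.2),
        (ht.inf_eq ▸ Finset.inf_le hq'.2 : _ ≤ q').trans Ideal.le_radical⟩ hle') hle'
    obtain ⟨s, hs, hsq⟩ := SetLike.not_le_iff_exists.1 hne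
    refine hsq (hyp ?_)
    rw [Submodule.mem_colon_singleton, Submodule.mem_bot, ← Submodule.Quotient.mk_smul,
      Submodule.Quotient.mk_eq_zero]
    apply (Ideal.mul_le_left : Ideal.span {a} * J ≤ _)
    rw [← ht.inf_eq, ← Finset.insert_erase hqt, Finset.inf_insert]
    exact ⟨q.mul_mem_left _ hyq, Ideal.mul_mem_right _ _ hs⟩
  · rw [Ideal.span_singleton_le_iff_mem]
    refine Submodule.mem_sInf.2 ?_
    rintro (q : Ideal R) ⟨hq, t, ht, hqt⟩
    have := Ideal.isPrime_radical (ht.primary hqt)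
    have hJq : ¬ J ≤ q.radical := fun h => by
      have h2 := two_le_height hb J hbJ hbq q.radical h
      rw [Ideal.height_radical_eq, hq, hI1] at h2
      exact absurd h2 (by decide)
    obtain ⟨j, hj, hjq⟩ := SetLike.not_le_iff_exists.1 hJq
    have haj : a * j ∈ q := (ht.inf_eq ▸ Finset.inf_le hqt : _ ≤ q)
      (Ideal.mem_span_singleton_mul.2 ⟨j, hj, rfl⟩)
    exact ((Ideal.isPrimary_iff.1 (ht.primary hqt)).2 haj).resolve_right hjq

end TwistedIdeal

/-! ### Depth of `R ⧸ J` and perfection -/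

open Abelian in
theorem subsingleton_ext_of_shortExact {R A B C : Type u} [CommRing R] [AddCommGroup A]
    [Module R A] [AddCommGroup B] [Module R B] [AddCommGroup C] [Module R C] {f : A →ₗ[R] B}
    {g : B →ₗ[R] C} (hf : Function.Injective f) (hg : Function.Surjective g)
    (h : Function.Exact f g) (N : ModuleCat.{u} R) (i : ℕ)
    (hB : Subsingleton (Ext N (ModuleCat.of R B) i))
    (hA : Subsingleton (Ext N (ModuleCat.of R A) (i + 1))) :
    Subsingleton (Ext N (ModuleCat.of R C) i) :=
  AddCommGrpCat.subsingleton_of_isZero <| ShortComplex.Exact.isZero_of_both_zeros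
    (Ext.covariant_sequence_exact₃' N (ModuleCat.shortExact_of_exact f g hf hg h) i (i + 1) rfl)
    ((AddCommGrpCat.isZero_of_iff_subsingleton.mpr hB).eq_zero_of_src _)
    ((AddCommGrpCat.isZero_of_iff_subsingleton.mpr hA).eq_zero_of_tgt _)

open Abelian in
theorem subsingleton_ext_fin_fun {R : Type u} [CommRing R] (N : ModuleCat.{u} R) (i : ℕ)
    (h : Subsingleton (Ext N (ModuleCat.of R R) i)) (n : ℕ) :
    Subsingleton (Ext N (ModuleCat.of R (Fin n → R)) i) := by
  induction n with
  | zero =>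
    have : Limits.IsZero (ModuleCat.of R (Fin 0 → R)) := ModuleCat.isZero_of_subsingleton _
    have := this.hasInjectiveDimensionLT_zero
    exact HasInjectiveDimensionLT.subsingleton _ 0 i (Nat.zero_le _) N
  | succ n ih =>
    have hS := ModuleCat.shortExact_of_exact (LinearMap.single R (fun _ : Fin (n + 1) => R) 0)
      (LinearMap.funLeft R R Fin.succ)
      (fun x y hxy => by simpa using congrFun hxy 0)
      (LinearMap.funLeft_surjective_of_injective R R _ (Fin.succ_injective n)) (fun w => by
        constructor
        · intro hw
          refine ⟨w 0, ?_⟩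
          ext j
          cases j using Fin.cases with
          | zero => simp
          | succ j => simpa using (congrFun hw j).symm
        · rintro ⟨x, rfl⟩
          ext j
          simp [LinearMap.funLeft])
    exact AddCommGrpCat.subsingleton_of_isZero <| ShortComplex.Exact.isZero_of_both_zeros
      (Ext.covariant_sequence_exact₂' N hS i)
      ((AddCommGrpCat.isZero_of_iff_subsingleton.mpr h).eq_zero_of_src _)
      ((AddCommGrpCat.isZero_of_iff_subsingleton.mpr ih).eq_zero_of_tgt _)

section

open RingTheory.Sequence IsLocalRing

variable {R : Type u} [CommRing R] [IsGorensteinLocalRing R] {J : Ideal R}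

/-- With `k` the residue field, Ext(k, R) vanishes below degree `d + 2`. The resolution of `J` and
then the sequence J → R → R/J each lose one degree, so Ext(k, R/J) vanishes below `d`, which bounds
the depth from below. -/
theorem exists_isRegular_quotient_of_free_resolution {d : ℕ} (hd : ringKrullDim R = (d + 2 : ℕ))
    (hJ : J ≠ ⊤) {m n : ℕ} {f : (Fin m → R) →ₗ[R] (Fin n → R)}
    {φ : (Fin n → R) →ₗ[R] J} (hf : Function.Injective f) (hφ : Function.Surjective φ)
    (h : Function.Exact f φ) :
    ∃ rs : List R, rs.length = d ∧ (∀ r ∈ rs, r ∈ maximalIdeal R) ∧ IsRegular (R ⧸ J) rs := by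
  obtain ⟨rs, reg, hrs⟩ := exists_isRegular_append ([] : List R) (IsRegular.nil R R)
  rw [List.nil_append] at reg hrs
  have hlen : rs.length = d + 2 := by
    rw [hd] at hrs
    exact_mod_cast hrs.symm
  let k : ModuleCat.{u} R := ModuleCat.of R (R ⧸ maximalIdeal R)
  have : Module.Finite R k := inferInstanceAs (Module.Finite R (R ⧸ maximalIdeal R))
  have : Module.Finite R (ModuleCat.of R R) := inferInstanceAs (Module.Finite R R)
  have : Module.Finite R (ModuleCat.of R (R ⧸ J)) := inferInstanceAs (Module.Finite R (R ⧸ J))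
  have hk : Module.support R (R ⧸ maximalIdeal R) = PrimeSpectrum.zeroLocus (maximalIdeal R) := by
    rw [Module.support_eq_zeroLocus, Ideal.annihilator_quotient]
  have lt (M : Type u) [AddCommGroup M] [Module R M] [Module.Finite R M] [Nontrivial M] :
      maximalIdeal R • (⊤ : Submodule R M) < ⊤ :=
    lt_top_iff_ne_top.2 (Submodule.top_ne_ideal_smul_of_le_jacobson_annihilator
      (maximalIdeal_le_jacobson _)).symm
  have hR := ModuleCat.subsingleton_ext_of_exists_isRegular (maximalIdeal R) k hk.le
    (ModuleCat.of R R) (lt R) rs (fun r hr => reg.mem_maximalIdeal hr) reg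
  have : Nontrivial (R ⧸ J) := Ideal.Quotient.nontrivial_iff.2 hJ
  refine ModuleCat.exists_isRegular_of_exists_subsingleton_ext (maximalIdeal R) d
    (ModuleCat.of R (R ⧸ J)) (lt (R ⧸ J)) k hk fun i hi => ?_
  refine subsingleton_ext_of_shortExact J.subtype_injective J.mkQ_surjective
    (LinearMap.exact_subtype_mkQ J) k i (hR i (by omega)) ?_
  exact subsingleton_ext_of_shortExact hf hφ h k (i + 1)
    (subsingleton_ext_fin_fun k _ (hR (i + 1) (by omega)) n)
    (subsingleton_ext_fin_fun k _ (hR (i + 1 + 1) (by omega)) m)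

variable {b : R}

theorem exists_isRegular_pair (hb : b ∈ nonZeroDivisors R) (hbJ : b ∈ J) (hJ : J ≠ ⊤)
    (hbq : ∀ p ∈ associatedPrimes R (R ⧸ Ideal.span {b}), ¬ J ≤ p) :
    ∃ y ∈ J, IsRegular R [b, y] := by
  obtain ⟨y, hyJ, hy⟩ : ∃ y ∈ J, IsSMulRegular (R ⧸ Ideal.span {b}) y := by
    by_contra! hcon
    obtain ⟨p, hp, hle⟩ :=
      (J.subset_union_prime_finite (associatedPrimes.finite R
        (R ⧸ Ideal.span {b})) (f := id) ⊥ ⊥ (fun _ h _ _ => h.isPrime)).1 <| by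
          simp_rw [id, biUnion_associatedPrimes_eq_compl_regular]
          exact fun x hx h => hcon x hx h
    exact hbq p hp hle
  refine ⟨y, hyJ, IsRegular.of_isWeaklyRegular_of_mem_maximalIdeal R ?_ ?_⟩
  · simpa using ⟨le_maximalIdeal hJ hbJ, le_maximalIdeal hJ hyJ⟩
  · rw [show [b, y] = [b] ++ [y] from rfl, isWeaklyRegular_append_iff,
      isWeaklyRegular_singleton_iff, isWeaklyRegular_singleton_iff]
    refine ⟨(isRegular_iff_mem_nonZeroDivisors.2 hb).left, ?_⟩
    have e : (R ⧸ Ideal.span {b}) ≃ₗ[R] (R ⧸ Ideal.ofList [b] • (⊤ : Submodule R R)) :=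
      Submodule.quotEquivOfEq _ _ (by simp)
    exact (e.isSMulRegular_congr y).mp hy

theorem length_le_of_isRegular_of_supportDim_eq {M : Type u} [AddCommGroup M] [Module R M]
    [Module.Finite R M] {e : ℕ} (he : Module.supportDim R M = e) (rs : List R)
    (reg : IsRegular M rs) : rs.length ≤ e := by
  have h1 := Module.supportDim_add_length_eq_supportDim_of_isRegular rs reg
  have : Nontrivial (M ⧸ Ideal.ofList rs • (⊤ : Submodule R M)) :=
    Submodule.Quotient.nontrivial_iff.2 reg.top_ne_smul.symm
  have h0 : 0 ≤ Module.supportDim R (M ⧸ Ideal.ofList rs • (⊤ : Submodule R M)) := by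
    have := Module.supportDim_ne_bot_of_nontrivial R (M ⧸ Ideal.ofList rs • (⊤ : Submodule R M))
    obtain ⟨n, hn⟩ := WithBot.ne_bot_iff_exists.1 this
    rw [← hn]
    exact WithBot.coe_le_coe.2 zero_le
  have h2 : ((rs.length : ℕ) : WithBot ℕ∞) ≤ (e : ℕ) := by
    rw [← he, ← h1]; exact le_add_of_nonneg_left h0
  exact_mod_cast h2

/-- A regular pair in `J` forces dim R/J ≤ dim R - 2, while the resolution gives depth at least dim
R - 2, so all are equal. The dimension bound for arbitrary regular sequences in `J` then caps the
grade at 2. -/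
theorem isCohenMacaulayModule_and_idealGrade_eq_two (hb : b ∈ nonZeroDivisors R) (hbJ : b ∈ J)
    (hJ : J ≠ ⊤) (hbq : ∀ p ∈ associatedPrimes R (R ⧸ Ideal.span {b}), ¬ J ≤ p)
    {m n : ℕ} {f : (Fin m → R) →ₗ[R] (Fin n → R)}
    {φ : (Fin n → R) →ₗ[R] J} (hf : Function.Injective f) (hφ : Function.Surjective φ)
    (h : Function.Exact f φ) :
    IsCohenMacaulayModule R (R ⧸ J) ∧ idealGrade J = 2 := by
  obtain ⟨y, hy, hby⟩ := exists_isRegular_pair hb hbJ hJ hbq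
  obtain ⟨d', hd'⟩ := exists_natCast_eq_ringKrullDim R
  have hdim (rs : List R) (reg : IsRegular R rs) (hrs : ∀ r ∈ rs, r ∈ J) :
      ringKrullDim (R ⧸ J) + rs.length ≤ d' := by
    rw [← hd', ← ringKrullDim_add_length_eq_ringKrullDim_of_isRegular rs reg]
    gcongr
    have hle : Ideal.ofList rs ≤ J := Ideal.span_le.2 hrs
    exact ringKrullDim_le_of_surjective _ (Ideal.Quotient.factor_surjective hle)
  have hJn : IsLocalRing (R ⧸ J) := by
    have : Nontrivial (R ⧸ J) := Ideal.Quotient.nontrivial_iff.2 hJ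
    exact IsLocalRing.of_surjective' _ Ideal.Quotient.mk_surjective
  obtain ⟨e, he⟩ := exists_natCast_eq_ringKrullDim (R ⧸ J)
  simp only [he] at hdim
  have hdim' (rs : List R) (reg : IsRegular R rs) (hrs : ∀ r ∈ rs, r ∈ J) : e + rs.length ≤ d' := by
    exact_mod_cast hdim rs reg hrs
  have h2 : e + 2 ≤ d' := hdim' [b, y] hby (by simpa using ⟨hbJ, hy⟩)
  obtain ⟨d, rfl⟩ := Nat.exists_eq_add_of_le' (show 2 ≤ d' by omega)
  obtain ⟨rs, hlen, hrs, reg⟩ := exists_isRegular_quotient_of_free_resolution hd' hJ hf hφ h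
  have hsupp : Module.supportDim R (R ⧸ J) = e := by
    rw [Module.supportDim_quotient_eq_ringKrullDim, he]
  have hde := length_le_of_isRegular_of_supportDim_eq hsupp rs reg
  obtain rfl : e = d := by omega
  refine ⟨⟨inferInstance, Or.inr ?_⟩, le_antisymm ?_ ?_⟩
  · have : gradeOn (maximalIdeal R) (R ⧸ J) = e := by
      apply le_antisymm
      · refine iSup_le fun ss => iSup_le fun hss => iSup_le fun _ => ?_
        exact_mod_cast length_le_of_isRegular_of_supportDim_eq hsupp ss hss
      · exact le_iSup_of_le rs (le_iSup_of_le reg (le_iSup_of_le hrs (by rw [hlen])))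
    rw [hsupp, this]
    rfl
  · refine iSup_le fun ss => iSup_le fun hss => iSup_le fun hmem => ?_
    have := hdim' ss hss hmem
    exact_mod_cast (show ss.length ≤ 2 by omega)
  · exact le_iSup_of_le [b, y] (le_iSup_of_le hby (le_iSup_of_le (by simpa using ⟨hbJ, hy⟩)
      (by simp)))

end

/-! ### The main theorem -/

theorem spanFinrank_le_one_of_eq_span_singleton {R : Type*} [CommRing R] {I : Ideal R} {a : R}
    (h : I = Ideal.span {a}) : I.spanFinrank ≤ 1 := by
  rw [h]
  simpa using Submodule.spanFinrank_span_le_ncard_of_finite (R := R) (Set.finite_singleton a)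

theorem proposition1p5 (R : Type u) [CommRing R] [IsGorensteinLocalRing R] (I : Ideal R)
    (h : (bettiNumber R I 1 : ℤ) - (bettiNumber R I 0 : ℤ) = -1)
    (h1 : bettiNumber R I 1 ≠ 0) :
    projDim R I = 1 ∧
      ((IsPerfectIdeal I ∧ idealGrade I = 2) ∨
        (idealGrade I = 1 ∧ ¬ IsUnmixedIdeal I ∧ (unmixedPart I).IsPrincipal)) := by
  have hproj : ¬ Module.Projective R I := fun _ => h1 (bettiNumber_one_of_projective I)
  obtain ⟨m, hm⟩ : ∃ m, bettiNumber R I 1 = m := ⟨_, rfl⟩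
  have h0 : bettiNumber R I 0 = m + 1 := by omega
  -- As `m ≠ 0`, at least two generators are needed; this is what later excludes `J = ⊤`.
  have hprinc (a : R) : I ≠ Ideal.span {a} := fun ha => by
    have := spanFinrank_le_one_of_eq_span_singleton ha
    rw [bettiNumber_zero, Submodule.spanFinrank_top] at h0
    omega
  obtain ⟨g, c, hg, hc⟩ := exists_minimal_presentation I hm h0
  have hR : ∀ p ∈ associatedPrimes R R, p.height = 0 := height_eq_zero_of_mem_associatedPrimes
  have hli := linearIndependent_relations c g hc hR
  obtain ⟨f, φ, hf, hφ, hfφ⟩ := exists_free_resolution hg hc hli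
  have hpd := projDim_eq_one hf hφ hfφ hproj
  refine ⟨hpd, ?_⟩
  obtain ⟨a, ha, hga, w, hw⟩ := hilbertBurch c g hc hli (exists_nonZeroDivisor_mem_span c g hc hR)
  let J : Ideal R := LinearMap.range (minorForm c)
  have hI : I = Ideal.span {a} * J := by
    ext x
    rw [← hg, Ideal.mem_span_range_iff_exists_fun, Ideal.mem_span_singleton_mul]
    simp [J, hga]
  have hbJ : minorForm c w ∈ J := ⟨w, rfl⟩
  have hbq : ∀ p ∈ associatedPrimes R (R ⧸ Ideal.span {minorForm c w}), ¬ J ≤ p := fun p hp hle => by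
    obtain ⟨v, hv⟩ := exists_minorForm_notMem_of_mem_associatedPrimes c g hc hli hw p hp
    exact hv (hle ⟨v, rfl⟩)
  have hJ : J ≠ ⊤ := fun hJ => hprinc a (by rw [hI, hJ, Ideal.mul_top])
  by_cases hau : IsUnit a
  · have hIJ : I = J := by rw [hI, Ideal.span_singleton_eq_top.2 hau, Ideal.top_mul]
    rw [← hIJ] at hbJ hbq hJ
    obtain ⟨hcm, hgr⟩ := isCohenMacaulayModule_and_idealGrade_eq_two hw hbJ hJ hbq hf hφ hfφ
    exact Or.inl ⟨⟨hcm, projDim_quotient_ne_top hpd⟩, hgr⟩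
  · have ham : a ∈ IsLocalRing.maximalIdeal R := (IsLocalRing.mem_maximalIdeal a).2 hau
    rw [hI]
    refine Or.inr ⟨?_, not_isUnmixedIdeal_span_singleton_mul J ha ham hw hbJ hJ hbq, ?_⟩
    · exact idealGrade_eq_one_of_le_span_singleton ham _ Ideal.mul_le_left (mul_mem ha hw)
        (Ideal.mem_span_singleton_mul.2 ⟨_, hbJ, rfl⟩)
    · rw [unmixedPart_eq_span_singleton J ha ham hw hbJ hbq]
      exact ⟨a, rfl⟩
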